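/- Let $Y$ be a real Hilbert space, $a>0$, $x_0\in Y$, and let $A:D(A)\subseteq Y\to Y$ generate a strongly continuous semigroup $(S(t))_{t\ge 0}$ on $Y$ such that $S(t)$ is compact for $0<t\le a$ and, for some $\mu>0$, $\langle -Ay,y\rangle\ge\mu\|y\|^2$ for all $y\in D(A)$. Let $F:[0,a]\times Y\to Y$ be such that $F(\cdot,y)$ is measurable for every $y\in Y$; $\|F(t,y)\|\le\alpha(t)+b\|y\|$ for all $t\in[0,a]$, $y\in Y$, with some $\alpha\in L^2(0,a)$, $b>0$; and $\langle F(t,y)-F(t,z),y-z\rangle\le 0$ for all $t\in[0,a]$, $y,z\in Y$. Suppose that for almost every $t\in[0,a]$ the map $F(t,\cdot)$ is continuously Fréchet differentiable with derivative $G(t,y)=\frac{\partial}{\partial y}F(t,y)$, and that $\int_0^a\|G(t,x(t))\|^2\,dt<\infty$ for every $x\in L^2([0,a],Y)$. Call $(u,x)$ admissible if $u\in L^2([0,a],Y)$ and $x\in C([0,a],Y)$ is a mild solution of $\dot x=Ax+F(t,x)+u$, $x(0)=x_0$, i.e. $x(t)=S(t)x_0+\int_0^tS(t-s)\,[F(s,x(s))+u(s)]\,ds$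 for $t\in[0,a]$. Call an admissible pair optimal if it minimizes $J(u,x)=\int_0^a\big(\langle u(t),u(t)\rangle+\langle x(t),x(t)\rangle\big)\,dt$ among all admissible pairs. Then an optimal pair exists, and every optimal pair $(u^*,x^*)$ (with $u^*$ replaced by a continuous function equal to it almost everywhere) satisfies the optimality system $$\dot x^*=Ax^*+F(t,x^*)+u^*,\qquad x^*(0)=x_0,$$ $$\dot u^*=-A^*u^*-G^*(t,x^*)u^*+x^*,\qquad u^*(a)=0 .$$ Here the equations hold in the mild sense, i.e. $x^*$ satisfies the formula above with $u=u^*$, and $$u^*(t)=\int_t^aS(s-t)^*\,\big[G(s,x^*(s))^*u^*(s)-x^*(s)\big]\,ds,\qquad t\in[0,a],$$ and also in the weak sense: for every $v\in D(A^*)$ the function $\langle x^*(t),v\rangle$ is absolutely continuous on $[0,a]$ with $\frac{d}{dt}\langle x^*,v\rangle=\langle x^*,A^*v\rangle+\langle F(t,x^*)+u^*,v\rangle$ for a.e. $t$, and for every $v\in D(A)$ the function $\langle u^*(t),v\rangle$ is absolutely continuous on $[0,a]$ with $\frac{d}{dt}\langle u^*,v\rangle=-\langle u^*,Av\rangle+\langle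 -G^*(t,x^*)u^*+x^*,v\rangle$ for a.e. $t$. -/

import Mathlib

open MeasureTheory Set Filter Topology
open scoped RealInnerProductSpace

noncomputable section

variable {Y : Type*} [NormedAddCommGroup Y] [InnerProductSpace ℝ Y]

/-- `S`, restricted to `[0, ∞)`, is a strongly continuous semigroup of bounded operators. -/
structure IsC0Semigroup (S : ℝ → Y →L[ℝ] Y) : Prop where
  zero : S 0 = ContinuousLinearMap.id ℝ Y
  add : ∀ s t : ℝ, 0 ≤ s → 0 ≤ t → S (s + t) = (S s).comp (S t)
  strongly_continuous : ∀ y : Y, ContinuousOn (fun t => S t y) (Ici 0)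

/-- `A` (with its natural domain) is the infinitesimal generator of the strongly continuous
semigroup `S`: `y ∈ D(A)` and `A y = z` iff `(S t y - y) / t → z` as `t ↓ 0`. -/
structure IsGenerator (A : Y →ₗ.[ℝ] Y) (S : ℝ → Y →L[ℝ] Y) : Prop where
  semigroup : IsC0Semigroup S
  generator : ∀ y z : Y, (∃ h : y ∈ A.domain, A ⟨y, h⟩ = z) ↔
    Tendsto (fun t : ℝ => t⁻¹ • (S t y - y)) (𝓝[>] 0) (𝓝 z)

/-- `u` belongs to `L²([0, a], V)`. -/
def IsL2 {V : Type*} [NormedAddCommGroup V] (a : ℝ) (u : ℝ → V) : Prop :=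
  MemLp u 2 (volume.restrict (Icc 0 a))

/-- `x ∈ C([0, a], Y)` is the mild solution of `ẋ = A x + f` on `[0, a]`, `x(0) = x₀`, where `A`
generates `S`. -/
def IsMildSolution (a : ℝ) (S : ℝ → Y →L[ℝ] Y) (x₀ : Y) (f x : ℝ → Y) : Prop :=
  ContinuousOn x (Icc 0 a) ∧
  ∀ t ∈ Icc 0 a, IntervalIntegrable (fun s => S (t - s) (f s)) volume 0 t ∧
    x t = S t x₀ + ∫ s in (0 : ℝ)..t, S (t - s) (f s)

/-- `p ∈ C([0, a], Y)` is the mild solution of the backward equation `ṗ = -A* p - f` on `[0, a]`,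
`p(a) = p₁`, where `A` generates `S` (so that `A*` generates the adjoint semigroup). -/
def IsBackwardMildSolution [CompleteSpace Y] (a : ℝ) (S : ℝ → Y →L[ℝ] Y) (p₁ : Y) (f p : ℝ → Y) :
    Prop :=
  ContinuousOn p (Icc 0 a) ∧
  ∀ t ∈ Icc 0 a,
    IntervalIntegrable (fun s => ContinuousLinearMap.adjoint (S (s - t)) (f s)) volume t a ∧
    p t = ContinuousLinearMap.adjoint (S (a - t)) p₁ +
      ∫ s in t..a, ContinuousLinearMap.adjoint (S (s - t)) (f s)

/-- `x` satisfies the differential equation `ẋ = M* x + f` on `[0, a]` in the weak sense: for every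
`v ∈ D(M)` the function `t ↦ ⟪x(t), v⟫` is absolutely continuous on `[0, a]` and
`d/dt ⟪x(t), v⟫ = ⟪x(t), M v⟫ + ⟪f(t), v⟫` for almost every `t`.
For a closed densely defined `A`, the choice `M = A*` gives `ẋ = A x + f` (as `A** = A`), and the
choice `M = -A` gives `ẋ = -A* x + f`. -/
def IsWeakSolution (a : ℝ) (M : Y →ₗ.[ℝ] Y) (f x : ℝ → Y) : Prop :=
  ∀ v : M.domain,
    AbsolutelyContinuousOnInterval (fun t => ⟪x t, (v : Y)⟫) 0 a ∧
    ∀ᵐ t ∂(volume.restrict (Icc 0 a)),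
      HasDerivAt (fun t => ⟪x t, (v : Y)⟫) (⟪x t, M v⟫ + ⟪f t, (v : Y)⟫) t

/-- Admissible control-state pairs: `u ∈ L²([0, a], Y)` and `x` is the mild solution of
`ẋ = A x + F(t, x) + u`, `x(0) = x₀`. -/
def IsAdmissible (a : ℝ) (S : ℝ → Y →L[ℝ] Y) (F : ℝ → Y → Y) (x₀ : Y) (u x : ℝ → Y) : Prop :=
  IsL2 a u ∧ IsMildSolution a S x₀ (fun t => F t (x t) + u t) x

/-- The quadratic cost `∫₀ᵃ ⟨u, u⟩ + ⟨x, x⟩ dt`. -/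
def quadraticCost (a : ℝ) (u x : ℝ → Y) : ℝ :=
  ∫ t in (0 : ℝ)..a, (⟪u t, u t⟫ + ⟪x t, x t⟫)

/-- `(u, x)` minimizes the cost among all admissible control-state pairs. -/
def IsOptimalPair (a : ℝ) (S : ℝ → Y →L[ℝ] Y) (F : ℝ → Y → Y) (x₀ : Y) (u x : ℝ → Y) : Prop :=
  IsAdmissible a S F x₀ u x ∧
  ∀ v y : ℝ → Y, IsAdmissible a S F x₀ v y → quadraticCost a u x ≤ quadraticCost a v y

end

/-! Dissipativity of `A` makes `S` a contraction semigroup, and its adjoint family is then strongly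
continuous as well. The convolution theory needs only these two properties, recorded in
`IsContractionFamily`, so it serves both the state equation and, after time reversal, the adjoint
equation.

The decisive change of variable is `w = F(t, x) + u`. Every `w` in L² determines a state `x = S(t)x₀
+ mildConv S w` and a control `u = w - F(t, x)`, and this pair is admissible
(`isAdmissible_of_forcing`). The problem becomes unconstrained in `w`, and the nonlinear equation
never has to be solved.

Existence (`exists_isOptimalPair`): along a minimizing sequence the forcings are bounded in L², so a
subsequence converges weakly. Compactness of `S` upgrades this to pointwise strong convergence of
the states (`tendsto_mildConv_of_weakly_null`). The `F`-terms then converge by domination, and the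
cost is weakly lower semicontinuous.

Optimality: perturbing `x` by `ε h`, with `h = mildConv S w`, gives the first variation `2∫(⟪u, w -
G h⟫ + ⟪x, h⟫)`, which vanishes because `w` can be replaced by `-w`. Moving the convolution to the
other side by Fubini (`integral_inner_mildConv`) yields `∫⟪u, w⟫ = ∫⟪p, w⟫` for all `w`, where `p`
is the backward convolution of `G* u - x`; hence `u = p` almost everywhere. Domination of the
difference quotients rests on an L² majorant of `G` along segments (`exists_memLp_bound_segment`),
and measurability of `G* u` on separability of `Y`, which compactness of `S` provides. The weak
equations follow from the mild ones by Fubini (`inner_mild_eq`). -/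

section

/-! ### Semigroups, generators, and contractivity of `S` and its adjoints. -/

variable {Y : Type*} [NormedAddCommGroup Y] [InnerProductSpace ℝ Y]

/-- A family of contractions on `Y`, strongly continuous on `[0, ∞)`. -/
structure IsContractionFamily (T : ℝ → Y →L[ℝ] Y) : Prop where
  norm_le : ∀ t : ℝ, 0 ≤ t → ∀ y : Y, ‖T t y‖ ≤ ‖y‖
  continuousOn : ∀ y : Y, ContinuousOn (fun t => T t y) (Ici 0)

namespace IsC0Semigroup

variable {S : ℝ → Y →L[ℝ] Y}

theorem add_apply (hS : IsC0Semigroup S) {s t : ℝ} (hs : 0 ≤ s) (ht : 0 ≤ t) (y : Y) :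
    S (s + t) y = S s (S t y) := by
  rw [hS.add s t hs ht]; rfl

theorem intervalIntegrable (hS : IsC0Semigroup S) (y : Y) {s t : ℝ} (hs : 0 ≤ s) (ht : 0 ≤ t) :
    IntervalIntegrable (fun r => S r y) volume s t :=
  ((hS.strongly_continuous y).mono fun _ hr =>
    le_trans (le_min hs ht) hr.1).intervalIntegrable

theorem tendsto_average [CompleteSpace Y] (hS : IsC0Semigroup S) (y : Y) {t : ℝ} (ht : 0 ≤ t) :
    Tendsto (fun r : ℝ => r⁻¹ • ∫ s in t..(t + r), S s y) (𝓝[>] 0) (𝓝 (S t y)) := by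
  have hd : HasDerivWithinAt (fun u => ∫ s in t..u, S s y) (S t y) (Ici t) t := by
    refine intervalIntegral.integral_hasDerivWithinAt_right (t := Ioi t) (by simp) ?_
      ((hS.strongly_continuous y t ht).mono fun r hr => le_trans ht (le_of_lt hr))
    refine ⟨Ioi t, self_mem_nhdsWithin, ?_⟩
    exact ((hS.strongly_continuous y).mono fun r hr =>
      le_trans ht (le_of_lt hr)).aestronglyMeasurable measurableSet_Ioi
  have h2 := (hasDerivWithinAt_iff_tendsto_slope' (s := Ioi t) (by simp)).1
    (hd.mono Ioi_subset_Ici_self)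
  have h3 : Tendsto (fun r : ℝ => t + r) (𝓝[>] 0) (𝓝[>] t) := by
    refine tendsto_nhdsWithin_iff.2 ⟨?_, ?_⟩
    · have : Tendsto (fun r : ℝ => t + r) (𝓝 0) (𝓝 (t + 0)) :=
        (continuous_const.add continuous_id).tendsto 0
      rw [add_zero] at this
      exact this.mono_left nhdsWithin_le_nhds
    · filter_upwards [self_mem_nhdsWithin] with r hr
      simpa using hr
  refine (h2.comp h3).congr fun r => ?_
  simp [slope_def_module]

/-- By the semigroup law `S r` shifts the interval of integration, so the difference is the integral
over `[t, t + r]` minus that over `[0, r]`; `tendsto_average` handles each. -/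
theorem tendsto_integral_orbit [CompleteSpace Y] (hS : IsC0Semigroup S) (y : Y) {t : ℝ}
    (ht : 0 ≤ t) :
    Tendsto (fun r : ℝ => r⁻¹ • (S r (∫ s in (0 : ℝ)..t, S s y) - ∫ s in (0 : ℝ)..t, S s y))
      (𝓝[>] 0) (𝓝 (S t y - y)) := by
  have h1 := hS.tendsto_average y ht
  have h2 := hS.tendsto_average y le_rfl
  rw [hS.zero] at h2
  refine (h1.sub h2).congr' ?_
  filter_upwards [self_mem_nhdsWithin] with r (hr : 0 < r)
  rw [← smul_sub]
  congr 1
  have e1 : S r (∫ s in (0 : ℝ)..t, S s y) = ∫ s in r..(r + t), S s y := by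
    rw [← ContinuousLinearMap.intervalIntegral_comp_comm _ (hS.intervalIntegrable y le_rfl ht)]
    have : ∫ s in (0 : ℝ)..t, S r (S s y) = ∫ s in (0 : ℝ)..t, S (r + s) y := by
      refine intervalIntegral.integral_congr fun s hs => ?_
      rw [uIcc_of_le ht] at hs
      exact (hS.add_apply hr.le hs.1 y).symm
    rw [this, intervalIntegral.integral_comp_add_left (fun s => S s y)]
    simp
  rw [e1]
  have i1 := hS.intervalIntegrable y le_rfl hr.le
  have i2 := hS.intervalIntegrable y hr.le (add_nonneg hr.le ht)
  have i3 := hS.intervalIntegrable y le_rfl ht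
  have i4 := hS.intervalIntegrable y ht (add_nonneg hr.le ht)
  have a1 := intervalIntegral.integral_add_adjacent_intervals i1 i2
  have a2 := intervalIntegral.integral_add_adjacent_intervals i3 i4
  rw [zero_add, add_comm t r, sub_eq_sub_iff_add_eq_add,
    add_comm (∫ s in t..(r + t), S s y), add_comm (∫ s in r..(r + t), S s y), a1, a2]

end IsC0Semigroup

namespace IsGenerator

variable {S : ℝ → Y →L[ℝ] Y} {A : Y →ₗ.[ℝ] Y}

theorem integral_orbit_mem [CompleteSpace Y] (h : IsGenerator A S) (y : Y) {t : ℝ} (ht : 0 ≤ t) :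
    ∃ hm : (∫ s in (0 : ℝ)..t, S s y) ∈ A.domain, A ⟨_, hm⟩ = S t y - y :=
  (h.generator _ _).2 (h.semigroup.tendsto_integral_orbit y ht)

/-- Orbit averages over `[0, r]` lie in the domain and tend to `y`. -/
theorem dense_domain [CompleteSpace Y] (h : IsGenerator A S) : Dense (A.domain : Set Y) := by
  intro y
  have h2 := h.semigroup.tendsto_average y le_rfl
  rw [h.semigroup.zero] at h2
  refine mem_closure_of_tendsto h2 ?_
  filter_upwards [self_mem_nhdsWithin] with r (hr : 0 < r)
  rw [zero_add]
  exact A.domain.smul_mem _ (h.integral_orbit_mem y hr.le).1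

theorem tendsto_orbit (h : IsGenerator A S) (y : A.domain) {t : ℝ} (ht : 0 ≤ t) :
    Tendsto (fun r : ℝ => r⁻¹ • (S (t + r) y - S t y)) (𝓝[>] 0) (𝓝 (S t (A y))) := by
  have h1 := (h.generator y (A y)).1 ⟨y.2, rfl⟩
  refine (((S t).continuous.tendsto _).comp h1).congr' ?_
  filter_upwards [self_mem_nhdsWithin] with r (hr : 0 < r)
  simp [h.semigroup.add_apply ht hr.le]

theorem orbit_mem (h : IsGenerator A S) (y : A.domain) {t : ℝ} (ht : 0 ≤ t) :
    ∃ hm : S t y ∈ A.domain, A ⟨_, hm⟩ = S t (A y) := by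
  refine (h.generator _ _).2 ((h.tendsto_orbit y ht).congr' ?_)
  filter_upwards [self_mem_nhdsWithin] with r (hr : 0 < r)
  rw [add_comm, h.semigroup.add_apply hr.le ht]

theorem hasDerivWithinAt_orbit (h : IsGenerator A S) (y : A.domain) {t : ℝ} (ht : 0 ≤ t) :
    HasDerivWithinAt (fun s => S s y) (S t (A y)) (Ioi t) t := by
  refine (hasDerivWithinAt_iff_tendsto_slope' (by simp)).2 ?_
  have h3 : Tendsto (fun r : ℝ => r - t) (𝓝[>] t) (𝓝[>] 0) := by
    refine tendsto_nhdsWithin_iff.2 ⟨?_, ?_⟩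
    · have : Tendsto (fun r : ℝ => r - t) (𝓝 t) (𝓝 (t - t)) :=
        (continuous_id.sub continuous_const).tendsto t
      rw [sub_self] at this
      exact this.mono_left nhdsWithin_le_nhds
    · filter_upwards [self_mem_nhdsWithin] with r hr
      simpa using hr
  refine ((h.tendsto_orbit y ht).comp h3).congr fun r => ?_
  simp [slope_def_module]

theorem apply_eq_add_integral [CompleteSpace Y] (h : IsGenerator A S) (y : A.domain) {t : ℝ}
    (ht : 0 ≤ t) : S t y = y + ∫ s in (0 : ℝ)..t, S s (A y) := by
  have := intervalIntegral.integral_eq_sub_of_hasDeriv_right (a := 0) (b := t)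
    (f := fun s => S s y) (f' := fun s => S s (A y))
    ((h.semigroup.strongly_continuous y).mono fun s hs => by
      rw [uIcc_of_le ht] at hs; exact hs.1)
    (fun s hs => h.hasDerivWithinAt_orbit y (by rw [min_eq_left ht] at hs; exact hs.1.le))
    (h.semigroup.intervalIntegrable _ le_rfl ht)
  rw [this, h.semigroup.zero]
  simp

/-- For `y` in the domain, `‖S s y‖²` has right derivative `2⟪S s y, A (S s y)⟫ ≤ 0`; density gives
the other vectors. -/
theorem norm_apply_le [CompleteSpace Y] (h : IsGenerator A S)
    (hA : ∀ y : A.domain, ⟪A y, (y : Y)⟫ ≤ 0) {t : ℝ} (ht : 0 ≤ t) (y : Y) : ‖S t y‖ ≤ ‖y‖ := by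
  have key : ∀ y ∈ (A.domain : Set Y), ‖S t y‖ ≤ ‖y‖ := by
    intro y hy
    have := image_le_of_deriv_right_le_deriv_boundary (a := 0) (b := t)
      (f := fun s => ‖S s y‖ ^ 2) (f' := fun s => 2 * ⟪S s y, S s (A ⟨y, hy⟩)⟫)
      (B := fun _ => ‖y‖ ^ 2) (B' := fun _ => 0)
      (((h.semigroup.strongly_continuous y).mono fun s hs => hs.1).norm.pow 2)
      (fun s hs => by
        have hd := (h.hasDerivWithinAt_orbit ⟨y, hy⟩ hs.1).norm_sq
        exact hasDerivWithinAt_Ioi_iff_Ici.1 hd)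
      (by simp [h.semigroup.zero]) continuousOn_const (fun s _ => hasDerivWithinAt_const _ _ _)
      (fun s hs => by
        obtain ⟨hm, e⟩ := h.orbit_mem ⟨y, hy⟩ hs.1
        have := hA ⟨_, hm⟩
        rw [e, real_inner_comm] at this
        linarith) ⟨ht, le_rfl⟩
    exact (sq_le_sq₀ (norm_nonneg _) (norm_nonneg _)).1 this
  exact (isClosed_le (S t).continuous.norm continuous_norm).closure_subset_iff.2 key
    (h.dense_domain y)

theorem isContractionFamily [CompleteSpace Y] (h : IsGenerator A S)
    (hA : ∀ y : A.domain, ⟪A y, (y : Y)⟫ ≤ 0) : IsContractionFamily S :=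
  ⟨fun _ ht y => h.norm_apply_le hA ht y, h.semigroup.strongly_continuous⟩

/-- The adjoints of a contraction semigroup are strongly continuous. -/
theorem isContractionFamily_adjoint [CompleteSpace Y] (h : IsGenerator A S)
    (hA : ∀ y : A.domain, ⟪A y, (y : Y)⟫ ≤ 0) :
    IsContractionFamily fun t => ContinuousLinearMap.adjoint (S t) := by
  have hn : ∀ t : ℝ, 0 ≤ t → ∀ y : Y, ‖ContinuousLinearMap.adjoint (S t) y‖ ≤ ‖y‖ := by
    intro t ht y
    have h1 : ‖S t‖ ≤ 1 := (S t).opNorm_le_bound zero_le_one fun z => by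
      simpa using h.norm_apply_le hA ht z
    have h2 : ‖ContinuousLinearMap.adjoint (S t)‖ ≤ 1 := by
      rwa [LinearIsometryEquiv.norm_map]
    simpa using (ContinuousLinearMap.adjoint (S t)).le_of_opNorm_le h2 y
  have hmul : ∀ s t : ℝ, 0 ≤ s → 0 ≤ t → ∀ y : Y, ContinuousLinearMap.adjoint (S (s + t)) y =
      ContinuousLinearMap.adjoint (S s) (ContinuousLinearMap.adjoint (S t) y) := by
    intro s t hs ht y
    rw [add_comm, h.semigroup.add t s ht hs, ContinuousLinearMap.adjoint_comp]
    rfl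
  refine ⟨hn, fun y => ?_⟩
  -- Expanding the square and using contractivity leaves only `S r y`, so strong continuity of the
  -- adjoints at 0 is inherited from `S`.
  have hb : ∀ r : ℝ, 0 ≤ r →
      ‖ContinuousLinearMap.adjoint (S r) y - y‖ ^ 2 ≤ 2 * ⟪y, y - S r y⟫ := by
    intro r hr
    have h1 := hn r hr y
    have h2 := norm_sub_sq_real (ContinuousLinearMap.adjoint (S r) y) y
    rw [ContinuousLinearMap.adjoint_inner_left] at h2
    rw [h2, inner_sub_right, real_inner_self_eq_norm_sq]
    nlinarith [norm_nonneg (ContinuousLinearMap.adjoint (S r) y)]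
  have hlim : Tendsto (fun r : ℝ => √(2 * ⟪y, y - S r y⟫)) (𝓝[≥] 0) (𝓝 0) := by
    have h1 := h.semigroup.strongly_continuous y 0 self_mem_Ici
    have h2 : ContinuousWithinAt (fun r : ℝ => √(2 * ⟪y, y - S r y⟫)) (Ici 0) 0 :=
      ((continuousWithinAt_const.inner (continuousWithinAt_const.sub h1)).const_mul 2).sqrt
    have h3 := h2.tendsto
    simpa [h.semigroup.zero] using h3
  -- The semigroup law and contractivity reduce any increment to one starting at time 0.
  have hdiff : ∀ s t : ℝ, 0 ≤ s → s ≤ t → ‖ContinuousLinearMap.adjoint (S t) y -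
      ContinuousLinearMap.adjoint (S s) y‖ ≤ √(2 * ⟪y, y - S (t - s) y⟫) := by
    intro s t hs hst
    have e := hmul s (t - s) hs (sub_nonneg.2 hst) y
    rw [add_sub_cancel] at e
    rw [e, ← map_sub]
    exact (hn s hs _).trans (Real.le_sqrt_of_sq_le (hb _ (sub_nonneg.2 hst)))
  intro t (ht : 0 ≤ t)
  refine tendsto_iff_norm_sub_tendsto_zero.2 ?_
  have habs : Tendsto (fun s : ℝ => |s - t|) (𝓝[≥] t ⊔ 𝓝[≤] t) (𝓝[≥] 0) := by
    refine tendsto_nhdsWithin_iff.2 ⟨?_, Eventually.of_forall fun s => mem_Ici.2 (abs_nonneg _)⟩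
    have : Tendsto (fun s : ℝ => |s - t|) (𝓝 t) (𝓝 |t - t|) := by
      exact (by fun_prop : Continuous fun s : ℝ => |s - t|).tendsto t
    rw [sub_self, abs_zero] at this
    exact this.mono_left (sup_le nhdsWithin_le_nhds nhdsWithin_le_nhds)
  have habs' : Tendsto (fun s : ℝ => |s - t|) (𝓝[Ici 0] t) (𝓝[≥] 0) := by
    refine habs.mono_left ?_
    rw [← nhdsWithin_union, Ici_union_Iic, nhdsWithin_univ]
    exact nhdsWithin_le_nhds
  refine squeeze_zero' (Eventually.of_forall fun _ => norm_nonneg _) ?_ (hlim.comp habs')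
  filter_upwards [self_mem_nhdsWithin] with s (hs : 0 ≤ s)
  rcases le_total s t with hst | hst
  · have := hdiff s t hs hst
    rw [norm_sub_rev] at this
    simpa [abs_of_nonpos (sub_nonpos.2 hst)] using this
  · simpa [abs_of_nonneg (sub_nonneg.2 hst)] using hdiff t s ht hst

/-- The weak form of the orbit equation, tested against the domain of the adjoint. -/
theorem inner_apply_adjoint [CompleteSpace Y] (h : IsGenerator A S) (v : A.adjoint.domain) (y : Y)
    {t : ℝ} (ht : 0 ≤ t) :
    ⟪S t y, (v : Y)⟫ = ⟪y, (v : Y)⟫ + ∫ s in (0 : ℝ)..t, ⟪S s y, A.adjoint v⟫ := by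
  obtain ⟨hm, e⟩ := h.integral_orbit_mem y ht
  have h1 := LinearPMap.adjoint_isFormalAdjoint h.dense_domain v ⟨_, hm⟩
  rw [e, inner_sub_right] at h1
  have h2 : ⟪A.adjoint v, ∫ s in (0 : ℝ)..t, S s y⟫ =
      ∫ s in (0 : ℝ)..t, ⟪A.adjoint v, S s y⟫ :=
    ((innerSL ℝ (A.adjoint v)).intervalIntegral_comp_comm
      (h.semigroup.intervalIntegrable y le_rfl ht)).symm
  simp only [real_inner_comm (A.adjoint v) _, real_inner_comm (v : Y) _] at h1 h2 ⊢
  simp only [real_inner_comm] at h1 h2 ⊢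
  linarith

theorem adjoint_inner_apply [CompleteSpace Y] (h : IsGenerator A S) (v : A.domain) (y : Y)
    {t : ℝ} (ht : 0 ≤ t) :
    ⟪ContinuousLinearMap.adjoint (S t) y, (v : Y)⟫ = ⟪y, (v : Y)⟫ +
      ∫ s in (0 : ℝ)..t, ⟪ContinuousLinearMap.adjoint (S s) y, A v⟫ := by
  have h2 : ⟪y, ∫ s in (0 : ℝ)..t, S s (A v)⟫ = ∫ s in (0 : ℝ)..t, ⟪y, S s (A v)⟫ :=
    ((innerSL ℝ y).intervalIntegral_comp_comm
      (h.semigroup.intervalIntegrable _ le_rfl ht)).symm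
  simp only [ContinuousLinearMap.adjoint_inner_left]
  rw [h.apply_eq_add_integral v ht, inner_add_right, h2]

end IsGenerator

end

/-! ### Convolutions with a contraction family and their weak form. -/

section

variable {Y : Type*} [NormedAddCommGroup Y] [InnerProductSpace ℝ Y]

/-- The convolution `∫₀ᵗ T(t - s) f(s) ds`. -/
noncomputable def mildConv (T : ℝ → Y →L[ℝ] Y) (f : ℝ → Y) (t : ℝ) : Y :=
  ∫ s in (0 : ℝ)..t, T (t - s) (f s)

theorem intervalIntegral_eq_setIntegral_Icc {E : Type*} [NormedAddCommGroup E] [NormedSpace ℝ E]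
    {s t : ℝ} (h : s ≤ t) (f : ℝ → E) : ∫ r in s..t, f r = ∫ r in Icc s t, f r := by
  rw [intervalIntegral.integral_of_le h, integral_Icc_eq_integral_Ioc]

theorem intervalIntegrable_iff_integrable_Icc {E : Type*} [NormedAddCommGroup E]
    {s t : ℝ} (h : s ≤ t) (f : ℝ → E) :
    IntervalIntegrable f volume s t ↔ Integrable f (volume.restrict (Icc s t)) := by
  rw [intervalIntegrable_iff_integrableOn_Icc_of_le h]; rfl

namespace IsContractionFamily

variable {T : ℝ → Y →L[ℝ] Y}

/-- The truncation `max · 0` extends the family to all real times, so that measurability of `T (t -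
s) (f s)` comes from composition with a continuous map. -/
theorem continuous_uncurry (hT : IsContractionFamily T) :
    Continuous fun p : ℝ × Y => T (max p.1 0) p.2 := by
  refine continuous_iff_continuousAt.2 fun p => tendsto_iff_norm_sub_tendsto_zero.2 ?_
  have h1 : Continuous fun r : ℝ => T (max r 0) p.2 :=
    (hT.continuousOn p.2).comp_continuous (by fun_prop) fun r => mem_Ici.2 (le_max_right _ _)
  have h2 : Continuous fun q : ℝ × Y => ‖q.2 - p.2‖ + ‖T (max q.1 0) p.2 - T (max p.1 0) p.2‖ :=
    (by fun_prop : Continuous fun q : ℝ × Y => ‖q.2 - p.2‖).add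
      ((h1.comp continuous_fst).sub continuous_const).norm
  have h3 := h2.tendsto p
  simp only [sub_self, norm_zero, add_zero] at h3
  refine squeeze_zero (fun _ => norm_nonneg _) (fun q => ?_) h3
  have e : T (max q.1 0) q.2 - T (max p.1 0) p.2 =
      T (max q.1 0) (q.2 - p.2) + (T (max q.1 0) p.2 - T (max p.1 0) p.2) := by
    rw [map_sub]; abel
  rw [e]
  exact (norm_add_le _ _).trans (add_le_add_left (hT.norm_le _ (le_max_right _ _) _) _)

theorem aestronglyMeasurable (hT : IsContractionFamily T) {X : Type*} [MeasurableSpace X]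
    {μ : Measure X} {r : X → ℝ} (hr : AEStronglyMeasurable r μ) {f : X → Y}
    (hf : AEStronglyMeasurable f μ) : AEStronglyMeasurable (fun s => T (max (r s) 0) (f s)) μ :=
  hT.continuous_uncurry.comp_aestronglyMeasurable (hr.prodMk hf)

theorem integrable (hT : IsContractionFamily T) {X : Type*} [MeasurableSpace X]
    {μ : Measure X} {r : X → ℝ} (hr : AEStronglyMeasurable r μ) {f : X → Y}
    (hf : Integrable f μ) : Integrable (fun s => T (max (r s) 0) (f s)) μ :=
  hf.mono (hT.aestronglyMeasurable hr hf.1)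
    (Eventually.of_forall fun _ => hT.norm_le _ (le_max_right _ _) _)

theorem intervalIntegrable (hT : IsContractionFamily T) {t : ℝ} (ht : 0 ≤ t) {f : ℝ → Y}
    (hf : Integrable f (volume.restrict (Icc 0 t))) :
    IntervalIntegrable (fun s => T (t - s) (f s)) volume 0 t := by
  rw [intervalIntegrable_iff_integrable_Icc ht]
  refine (hT.integrable (r := fun s => t - s) (by fun_prop) hf).congr ?_
  filter_upwards [ae_restrict_mem measurableSet_Icc] with s hs
  rw [max_eq_left (sub_nonneg.2 hs.2)]

theorem mildConv_eq (T : ℝ → Y →L[ℝ] Y) {a t : ℝ} (ht : t ∈ Icc 0 a) (f : ℝ → Y) :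
    mildConv T f t = ∫ s in Icc 0 a, (Iic t).indicator (fun s => T (max (t - s) 0) (f s)) s := by
  rw [mildConv, intervalIntegral_eq_setIntegral_Icc ht.1, integral_indicator measurableSet_Iic,
    Measure.restrict_restrict measurableSet_Iic]
  have : Iic t ∩ Icc 0 a = Icc 0 t := by
    ext s; simp only [mem_inter_iff, mem_Iic, mem_Icc]
    exact ⟨fun h => ⟨h.2.1, h.1⟩, fun h => ⟨h.2, h.1, h.2.trans ht.2⟩⟩
  rw [this]
  refine setIntegral_congr_fun measurableSet_Icc fun s hs => ?_
  simp only [max_eq_left (sub_nonneg.2 hs.2)]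

theorem norm_mildConv_le (hT : IsContractionFamily T) {a t : ℝ} (ht : t ∈ Icc 0 a) {f : ℝ → Y}
    (hf : Integrable f (volume.restrict (Icc 0 a))) :
    ‖mildConv T f t‖ ≤ ∫ s in Icc 0 a, ‖f s‖ := by
  rw [mildConv_eq T ht]
  refine norm_integral_le_of_norm_le hf.norm (Eventually.of_forall fun s => ?_)
  refine (norm_indicator_le_norm_self _ _).trans (hT.norm_le _ (le_max_right _ _) _)

theorem continuousOn_mildConv (hT : IsContractionFamily T) {a : ℝ} {f : ℝ → Y}
    (hf : Integrable f (volume.restrict (Icc 0 a))) : ContinuousOn (mildConv T f) (Icc 0 a) := by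
  have h : Continuous fun t => ∫ s in Icc 0 a,
      (Iic t).indicator (fun s => T (max (t - s) 0) (f s)) s := by
    refine continuous_iff_continuousAt.2 fun t => ?_
    refine continuousAt_of_dominated (bound := fun s => ‖f s‖) ?_ ?_ hf.norm ?_
    · exact Eventually.of_forall fun t =>
        (hT.aestronglyMeasurable (r := fun s => t - s) (by fun_prop) hf.1).indicator
          measurableSet_Iic
    · exact Eventually.of_forall fun t => Eventually.of_forall fun s =>
        (norm_indicator_le_norm_self _ _).trans (hT.norm_le _ (le_max_right _ _) _)
    -- The indicator can jump at time `t` only for the single value `s = t`.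
    · have hne : ∀ᵐ s ∂(volume.restrict (Icc 0 a)), s ≠ t :=
        ae_restrict_of_ae (Measure.ae_ne volume t)
      filter_upwards [hne] with s hs
      have hc : Continuous fun t => T (max (t - s) 0) (f s) :=
        hT.continuous_uncurry.comp (by fun_prop : Continuous fun t : ℝ => (t - s, f s))
      rcases lt_or_gt_of_ne hs with h | h
      · refine hc.continuousAt.congr ?_
        filter_upwards [lt_mem_nhds h] with r hr
        rw [indicator_of_mem (mem_Iic.2 hr.le)]
      · refine (continuousAt_const (y := (0 : Y))).congr ?_
        filter_upwards [gt_mem_nhds h] with r hr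
        rw [indicator_of_notMem]
        exact not_le.2 hr
  exact h.continuousOn.congr fun t ht => mildConv_eq T ht f

/-- Fubini on the triangle `s ≤ t`. This gives both the duality between the forward and backward
convolutions and the passage from mild to weak solutions. -/
theorem integral_inner_mildConv [CompleteSpace Y] (hT : IsContractionFamily T) {a : ℝ}
    {f g : ℝ → Y}
    (hf : Integrable f (volume.restrict (Icc 0 a))) (hg : Integrable g (volume.restrict (Icc 0 a))) :
    ∫ t in Icc 0 a, ⟪g t, mildConv T f t⟫ =
      ∫ s in Icc 0 a, ∫ t in s..a, ⟪g t, T (t - s) (f s)⟫ := by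
  set μ := volume.restrict (Icc 0 a) with hμ
  let k : ℝ → ℝ → Y := fun t s => (Iic t).indicator (fun s => T (max (t - s) 0) (f s)) s
  have hk : ∀ t s, ‖k t s‖ ≤ ‖f s‖ := fun t s =>
    (norm_indicator_le_norm_self _ _).trans (hT.norm_le _ (le_max_right _ _) _)
  have hkm : AEStronglyMeasurable (Function.uncurry k) (μ.prod μ) := by
    have h1 : AEStronglyMeasurable (fun p : ℝ × ℝ => T (max (p.1 - p.2) 0) (f p.2)) (μ.prod μ) :=
      hT.aestronglyMeasurable (r := fun p : ℝ × ℝ => p.1 - p.2) (by fun_prop) hf.1.comp_snd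
    exact h1.indicator (measurableSet_le measurable_snd measurable_fst)
  have hint : Integrable (Function.uncurry fun t s => ⟪g t, k t s⟫) (μ.prod μ) := by
    refine (hg.norm.mul_prod hf.norm).mono' (hg.1.comp_fst.inner hkm)
      (Eventually.of_forall fun p => ?_)
    exact (norm_inner_le_norm _ _).trans (mul_le_mul_of_nonneg_left (hk _ _) (norm_nonneg _))
  have h1 : ∫ t in Icc 0 a, ⟪g t, mildConv T f t⟫ = ∫ t, ∫ s, ⟪g t, k t s⟫ ∂μ ∂μ := by
    refine setIntegral_congr_fun measurableSet_Icc fun t ht => ?_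
    simp only [mildConv_eq T ht]
    refine ((innerSL ℝ (g t)).integral_comp_comm ?_).symm
    exact (hT.integrable (r := fun s => t - s) (by fun_prop) hf).indicator measurableSet_Iic
  rw [h1, integral_integral_swap hint]
  refine setIntegral_congr_fun measurableSet_Icc fun s hs => ?_
  have e : (fun t => ⟪g t, k t s⟫) =
      (Ici s).indicator fun t => ⟪g t, T (max (t - s) 0) (f s)⟫ := by
    ext t
    by_cases h : s ≤ t
    · rw [indicator_of_mem (mem_Ici.2 h)]
      simp only [k]
      rw [indicator_of_mem (mem_Iic.2 h)]
    · rw [indicator_of_notMem (by simpa using h)]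
      simp only [k]
      rw [indicator_of_notMem (by simpa using h), inner_zero_right]
  have e2 : Ici s ∩ Icc 0 a = Icc s a := by
    ext r; simp only [mem_inter_iff, mem_Ici, mem_Icc]
    exact ⟨fun h => ⟨h.1, h.2.2⟩, fun h => ⟨h.1, hs.1.trans h.1, h.2⟩⟩
  simp only [e]
  rw [integral_indicator measurableSet_Ici, hμ, Measure.restrict_restrict measurableSet_Ici, e2,
    intervalIntegral_eq_setIntegral_Icc hs.2]
  refine setIntegral_congr_fun measurableSet_Icc fun t ht => ?_
  simp only [max_eq_left (sub_nonneg.2 ht.1)]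

/-- The weak (integrated) form of a mild solution. -/
theorem inner_mild_eq [CompleteSpace Y] (hT : IsContractionFamily T) {a : ℝ} {f x : ℝ → Y}
    {x₀ v w : Y}
    (hv : ∀ (y : Y) (t : ℝ), 0 ≤ t → ⟪T t y, v⟫ = ⟪y, v⟫ + ∫ s in (0 : ℝ)..t, ⟪T s y, w⟫)
    (hf : Integrable f (volume.restrict (Icc 0 a)))
    (hx : ∀ t ∈ Icc 0 a, x t = T t x₀ + mildConv T f t) {t : ℝ} (ht : t ∈ Icc 0 a) :
    ⟪x t, v⟫ = ⟪x₀, v⟫ + ∫ s in (0 : ℝ)..t, (⟪x s, w⟫ + ⟪f s, v⟫) := by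
  have hft : Integrable f (volume.restrict (Icc 0 t)) :=
    hf.mono_measure (Measure.restrict_mono (Icc_subset_Icc_right ht.2) le_rfl)
  have hI := hT.intervalIntegrable ht.1 hft
  have hfv : IntervalIntegrable (fun s => ⟪f s, v⟫) volume 0 t := by
    rw [intervalIntegrable_iff_integrable_Icc ht.1]
    exact hft.inner_const v
  have hTfv : IntervalIntegrable (fun s => ⟪T (t - s) (f s), v⟫) volume 0 t := by
    rw [intervalIntegrable_iff_integrable_Icc ht.1] at hI ⊢
    exact hI.inner_const v
  have hcc : ContinuousOn (mildConv T f) (Icc 0 t) := hT.continuousOn_mildConv hft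
  have hcw : IntervalIntegrable (fun s => ⟪mildConv T f s, w⟫) volume 0 t :=
    (hcc.inner continuousOn_const).intervalIntegrable_of_Icc ht.1
  have hTw : IntervalIntegrable (fun s => ⟪T s x₀, w⟫) volume 0 t :=
    (((hT.continuousOn x₀).mono fun s hs => hs.1).inner
      continuousOn_const).intervalIntegrable_of_Icc ht.1
  have h1 : ⟪mildConv T f t, v⟫ = ∫ s in (0 : ℝ)..t, ⟪T (t - s) (f s), v⟫ := by
    rw [real_inner_comm]
    have := ((innerSL ℝ v).intervalIntegral_comp_comm hI).symm
    rw [mildConv]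
    refine this.trans ?_
    exact intervalIntegral.integral_congr fun s _ => real_inner_comm _ _
  -- For each `s` the orbit identity `hv` is applied to the vector `f s`; Fubini in `h3` then
  -- recovers the convolution paired with `w`.
  have h2 : ∫ s in (0 : ℝ)..t, (⟪T (t - s) (f s), v⟫ - ⟪f s, v⟫) =
      ∫ s in Icc 0 t, ∫ r in s..t, ⟪w, T (r - s) (f s)⟫ := by
    rw [intervalIntegral_eq_setIntegral_Icc ht.1]
    refine setIntegral_congr_fun measurableSet_Icc fun s hs => ?_
    rw [hv _ _ (sub_nonneg.2 hs.2), add_sub_cancel_left,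
      intervalIntegral.integral_comp_sub_right (fun r => ⟪w, T r (f s)⟫), sub_self]
    exact intervalIntegral.integral_congr fun s _ => real_inner_comm _ _
  have h3 := hT.integral_inner_mildConv hft (g := fun _ => w) (integrable_const _)
  rw [← h2, intervalIntegral.integral_sub hTfv hfv, ← h1,
    ← intervalIntegral_eq_setIntegral_Icc ht.1] at h3
  simp only [real_inner_comm _ w] at h3
  have h4 : ∫ s in (0 : ℝ)..t, (⟪x s, w⟫ + ⟪f s, v⟫) =
      ∫ s in (0 : ℝ)..t, (⟪T s x₀, w⟫ + ⟪mildConv T f s, w⟫ + ⟪f s, v⟫) := by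
    refine intervalIntegral.integral_congr fun s hs => ?_
    rw [uIcc_of_le ht.1] at hs
    rw [hx s ⟨hs.1, hs.2.trans ht.2⟩, inner_add_left]
  rw [h4, intervalIntegral.integral_add (hTw.add hcw) hfv, intervalIntegral.integral_add hTw hcw,
    hx t ht, inner_add_left, hv x₀ t ht.1]
  linarith

end IsContractionFamily

/-- A scalar function which on `[0, a]` is a primitive of an integrable function is absolutely
continuous there, with the expected derivative. -/
theorem absolutelyContinuousOnInterval_of_eq_integral {a c : ℝ} (ha : 0 < a) {φ ψ : ℝ → ℝ}
    (hψ : IntervalIntegrable ψ volume 0 a)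
    (h : ∀ t ∈ Icc 0 a, φ t = c + ∫ s in (0 : ℝ)..t, ψ s) :
    AbsolutelyContinuousOnInterval φ 0 a ∧
      ∀ᵐ t ∂(volume.restrict (Icc 0 a)), HasDerivAt φ (ψ t) t := by
  constructor
  · have h1 : AbsolutelyContinuousOnInterval (fun _ : ℝ => c) 0 a :=
      (LipschitzWith.const c).lipschitzOnWith.absolutelyContinuousOnInterval
    have h2 := h1.add (hψ.absolutelyContinuousOnInterval_intervalIntegral
      (left_mem_uIcc : (0 : ℝ) ∈ uIcc 0 a))
    rw [absolutelyContinuousOnInterval_iff] at h2 ⊢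
    intro ε hε
    obtain ⟨δ, hδ, H⟩ := h2 ε hε
    refine ⟨δ, hδ, fun E hE hlt => ?_⟩
    refine lt_of_eq_of_lt (Finset.sum_congr rfl fun i hi => ?_) (H E hE hlt)
    have := hE.1 i hi
    rw [uIcc_of_le ha.le] at this
    rw [h _ this.1, h _ this.2]
    rfl
  · have h1 := hψ.ae_hasDerivAt_integral
    rw [uIcc_of_le ha.le] at h1
    have h2 : ∀ᵐ t ∂(volume.restrict (Icc 0 a)), t ∈ Ioo 0 a := by
      rw [restrict_Ioo_eq_restrict_Icc.symm]
      exact ae_restrict_mem measurableSet_Ioo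
    filter_upwards [ae_restrict_of_ae h1, h2] with t ht hm
    have hd := (ht ⟨hm.1.le, hm.2.le⟩ 0 ⟨le_rfl, ha.le⟩).const_add c
    refine hd.congr_of_eventuallyEq ?_
    filter_upwards [Ioo_mem_nhds hm.1 hm.2] with s hs
    exact h s ⟨hs.1.le, hs.2.le⟩

end

/-! ### Forward and backward mild solutions are weak solutions. -/

section

variable {Y : Type*} [NormedAddCommGroup Y] [InnerProductSpace ℝ Y]

theorem mildConv_reverse (T : ℝ → Y →L[ℝ] Y) (f : ℝ → Y) (a t : ℝ) :
    mildConv T (fun s => f (a - s)) t = ∫ s in (a - t)..a, T (s - (a - t)) (f s) := by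
  have := intervalIntegral.integral_comp_sub_left (a := 0) (b := t)
    (fun r => T (r - (a - t)) (f r)) a
  rw [sub_zero] at this
  rw [← this, mildConv]
  refine intervalIntegral.integral_congr fun s _ => ?_
  have e : a - s - (a - t) = t - s := by ring
  simp only [e]

theorem integrable_comp_sub_left_Icc {E : Type*} [NormedAddCommGroup E] {a : ℝ} (ha : 0 ≤ a)
    {f : ℝ → E}
    (hf : Integrable f (volume.restrict (Icc 0 a))) :
    Integrable (fun s => f (a - s)) (volume.restrict (Icc 0 a)) := by
  rw [← intervalIntegrable_iff_integrable_Icc ha] at hf ⊢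
  have := (hf.comp_sub_left a).symm
  rwa [sub_zero, sub_self] at this

theorem intervalIntegrable_inner_add_inner {a : ℝ} {f x : ℝ → Y}
    (hx : ContinuousOn x (Icc 0 a))
    (ha : 0 ≤ a) (hf : Integrable f (volume.restrict (Icc 0 a))) (v w : Y) :
    IntervalIntegrable (fun s => ⟪x s, w⟫ + ⟪f s, v⟫) volume 0 a := by
  refine ((hx.inner continuousOn_const).intervalIntegrable_of_Icc ha).add ?_
  rw [intervalIntegrable_iff_integrable_Icc ha]
  exact hf.inner_const v

variable [CompleteSpace Y] {S : ℝ → Y →L[ℝ] Y} {A : Y →ₗ.[ℝ] Y}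

theorem IsMildSolution.isWeakSolution (hS : IsGenerator A S)
    (hA : ∀ y : A.domain, ⟪A y, (y : Y)⟫ ≤ 0) {a : ℝ} (ha : 0 < a) {x₀ : Y} {f x : ℝ → Y}
    (hf : Integrable f (volume.restrict (Icc 0 a))) (hx : IsMildSolution a S x₀ f x) :
    IsWeakSolution a A.adjoint f x := fun v =>
  absolutelyContinuousOnInterval_of_eq_integral ha
    (intervalIntegrable_inner_add_inner hx.1 ha.le hf v (A.adjoint v)) fun _ ht =>
    (hS.isContractionFamily hA).inner_mild_eq (fun y _ hs => hS.inner_apply_adjoint v y hs) hf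
      (fun t ht => (hx.2 t ht).2) ht

theorem isBackwardMildSolution_integral (hS : IsGenerator A S)
    (hA : ∀ y : A.domain, ⟪A y, (y : Y)⟫ ≤ 0) {a : ℝ} (ha : 0 < a) {f : ℝ → Y}
    (hf : Integrable f (volume.restrict (Icc 0 a))) :
    IsBackwardMildSolution a S 0 f
      (fun t => ∫ s in t..a, ContinuousLinearMap.adjoint (S (s - t)) (f s)) := by
  have hT := hS.isContractionFamily_adjoint hA
  constructor
  · have h1 := hT.continuousOn_mildConv (integrable_comp_sub_left_Icc ha.le hf)
    have h2 : ContinuousOn (fun t : ℝ => a - t) (Icc 0 a) := by fun_prop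
    refine (h1.comp h2 fun t ht => ⟨sub_nonneg.2 ht.2, sub_le_self _ ht.1⟩).congr fun t _ => ?_
    simp only [Function.comp, mildConv_reverse, sub_sub_cancel]
  · intro t ht
    refine ⟨?_, by simp⟩
    rw [intervalIntegrable_iff_integrable_Icc ht.2]
    have hft : Integrable f (volume.restrict (Icc t a)) :=
      hf.mono_measure (Measure.restrict_mono (Icc_subset_Icc_left ht.1) le_rfl)
    refine (hT.integrable (r := fun s => s - t) (by fun_prop) hft).congr ?_
    filter_upwards [ae_restrict_mem measurableSet_Icc] with s hs
    rw [max_eq_left (sub_nonneg.2 hs.1)]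

/-- Under `t ↦ a - t` the function `p` is a forward mild solution for the adjoint family, so
`inner_mild_eq` applies; reversing time again flips the signs. -/
theorem IsBackwardMildSolution.isWeakSolution (hS : IsGenerator A S)
    (hA : ∀ y : A.domain, ⟪A y, (y : Y)⟫ ≤ 0) {a : ℝ} (ha : 0 < a) {p₁ : Y} {f p : ℝ → Y}
    (hf : Integrable f (volume.restrict (Icc 0 a))) (hp : IsBackwardMildSolution a S p₁ f p) :
    IsWeakSolution a (-A) (fun t => -f t) p := by
  intro v
  have hT := hS.isContractionFamily_adjoint hA
  let w : Y := A ⟨v, v.2⟩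
  have key : ∀ t ∈ Icc 0 a, ⟪p t, (v : Y)⟫ =
      ⟪p₁, (v : Y)⟫ + ∫ s in t..a, (⟪p s, w⟫ + ⟪f s, (v : Y)⟫) := by
    intro t ht
    have h1 := hT.inner_mild_eq (a := a) (f := fun s => f (a - s)) (x := fun s => p (a - s))
      (x₀ := p₁) (v := v) (w := w) (fun y s hs => hS.adjoint_inner_apply ⟨v, v.2⟩ y hs)
      (integrable_comp_sub_left_Icc ha.le hf) (fun t ht => by
        rw [mildConv_reverse]
        simpa using (hp.2 (a - t) ⟨sub_nonneg.2 ht.2, sub_le_self _ ht.1⟩).2)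
      (t := a - t) ⟨sub_nonneg.2 ht.2, sub_le_self _ ht.1⟩
    rw [intervalIntegral.integral_comp_sub_left
      (fun r => ⟪p r, w⟫ + ⟪f r, (v : Y)⟫) a] at h1
    simpa using h1
  have hi := intervalIntegrable_inner_add_inner hp.1 ha.le hf (v : Y) w
  have h2 := absolutelyContinuousOnInterval_of_eq_integral ha (φ := fun t => ⟪p t, (v : Y)⟫)
    (c := ⟪p₁, (v : Y)⟫ + ∫ s in (0 : ℝ)..a, (⟪p s, w⟫ + ⟪f s, (v : Y)⟫)) hi.neg (by
      intro t ht
      have h0t : IntervalIntegrable (fun s => ⟪p s, w⟫ + ⟪f s, (v : Y)⟫) volume 0 t :=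
        hi.mono_set (by
          rw [uIcc_of_le ht.1, uIcc_of_le ha.le]; exact Icc_subset_Icc_right ht.2)
      have hta : IntervalIntegrable (fun s => ⟪p s, w⟫ + ⟪f s, (v : Y)⟫) volume t a :=
        hi.mono_set (by
          rw [uIcc_of_le ht.2, uIcc_of_le ha.le]; exact Icc_subset_Icc_left ht.1)
      simp only [key t ht, Pi.neg_apply, intervalIntegral.integral_neg]
      rw [← intervalIntegral.integral_add_adjacent_intervals h0t hta]
      ring)
  refine ⟨h2.1, ?_⟩
  filter_upwards [h2.2] with t ht
  refine ht.congr_deriv ?_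
  have e : (-A) v = -w := rfl
  rw [e, inner_neg_right, inner_neg_left, Pi.neg_apply]
  ring

theorem IsMildSolution.congr_forcing {V : Type*} [NormedAddCommGroup V] [InnerProductSpace ℝ V]
    {T : ℝ → V →L[ℝ] V} {a : ℝ} {x₀ : V} {f g x : ℝ → V} (hx : IsMildSolution a T x₀ f x)
    (hfg : f =ᵐ[volume.restrict (Icc 0 a)] g) : IsMildSolution a T x₀ g x := by
  refine ⟨hx.1, fun t ht => ?_⟩
  have h1 : (fun s => T (t - s) (f s)) =ᵐ[volume.restrict (uIoc 0 t)]
      fun s => T (t - s) (g s) := by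
    rw [uIoc_of_le ht.1]
    filter_upwards [ae_restrict_of_ae_restrict_of_subset
      (Ioc_subset_Icc_self.trans (Icc_subset_Icc_right ht.2)) hfg] with s hs
    rw [hs]
  refine ⟨(hx.2 t ht).1.congr_ae h1, ?_⟩
  rw [(hx.2 t ht).2, intervalIntegral.integral_congr_ae_restrict h1]

theorem IsBackwardMildSolution.congr_forcing {a : ℝ} {p₁ : Y} {f g p : ℝ → Y}
    (hp : IsBackwardMildSolution a S p₁ f p) (hfg : f =ᵐ[volume.restrict (Icc 0 a)] g) :
    IsBackwardMildSolution a S p₁ g p := by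
  refine ⟨hp.1, fun t ht => ?_⟩
  have h1 : (fun s => ContinuousLinearMap.adjoint (S (s - t)) (f s)) =ᵐ[volume.restrict (uIoc t a)]
      fun s => ContinuousLinearMap.adjoint (S (s - t)) (g s) := by
    rw [uIoc_of_le ht.2]
    filter_upwards [ae_restrict_of_ae_restrict_of_subset
      (Ioc_subset_Icc_self.trans (Icc_subset_Icc_left ht.1)) hfg] with s hs
    rw [hs]
  refine ⟨(hp.2 t ht).1.congr_ae h1, ?_⟩
  rw [(hp.2 t ht).2, intervalIntegral.integral_congr_ae_restrict h1]

end

/-! ### Measurability of superpositions, and L² majorants of the derivative. -/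

section Measurability

variable {X : Type*} [MeasurableSpace X] {μ : Measure X}

/-- Superposition of a Carathéodory function with a measurable function. -/
theorem aestronglyMeasurable_caratheodory {V W : Type*} [TopologicalSpace V]
    [NormedAddCommGroup W] {F : X → V → W}
    (hF : ∀ y, AEStronglyMeasurable (fun t => F t y) μ) (hc : ∀ᵐ t ∂μ, Continuous (F t))
    {x : X → V} (hx : AEStronglyMeasurable x μ) : AEStronglyMeasurable (fun t => F t (x t)) μ := by
  obtain ⟨xm, hxm, hxe⟩ := hx
  have hs : ∀ s : SimpleFunc X V, AEStronglyMeasurable (fun t => F t (s t)) μ := by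
    classical
    intro s
    have e : (fun t => F t (s t)) =
        fun t => ∑ y ∈ s.range, (s ⁻¹' {y}).indicator (fun t => F t y) t := by
      ext t
      rw [Finset.sum_eq_single (s t)]
      · simp
      · intro y _ hy
        rw [indicator_of_notMem]
        simpa using hy.symm
      · intro h
        exact absurd (s.mem_range_self t) h
    rw [e]
    exact Finset.aestronglyMeasurable_fun_sum _ fun y _ =>
      (hF y).indicator (s.measurableSet_fiber y)
  have h1 : AEStronglyMeasurable (fun t => F t (xm t)) μ := by
    refine aestronglyMeasurable_of_tendsto_ae atTop (fun n => hs (hxm.approx n)) ?_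
    filter_upwards [hc] with t ht
    exact (ht.tendsto _).comp (hxm.tendsto_approx t)
  refine h1.congr ?_
  filter_upwards [hxe] with t ht
  rw [ht]

/-- A countable family of functions, bounded at almost every point, has a measurable selection of
almost maximizing indices. -/
theorem exists_measurable_almost_max {φ : ℕ → X → ℝ} (hφ : ∀ n, AEStronglyMeasurable (φ n) μ)
    (hb : ∀ᵐ t ∂μ, BddAbove (range fun n => φ n t)) :
    ∃ N : X → ℕ, Measurable N ∧ ∀ᵐ t ∂μ, ∀ m, φ m t ≤ φ (N t) t + 1 := by
  classical
  let ψ : ℕ → X → ℝ := fun n => (hφ n).mk (φ n)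
  have hψ : ∀ n, Measurable (ψ n) := fun n => (hφ n).stronglyMeasurable_mk.measurable
  -- The second alternative keeps `p t` satisfiable at the exceptional points, so that `Nat.find` is
  -- defined everywhere.
  let p : X → ℕ → Prop := fun t n =>
    (∀ m, ψ m t ≤ ψ n t + 1) ∨ ¬ ∃ k, ∀ m, ψ m t ≤ ψ k t + 1
  have hp : ∀ t, ∃ n, p t n := by
    intro t
    by_cases h : ∃ k, ∀ m, ψ m t ≤ ψ k t + 1
    · exact h.imp fun k hk => Or.inl hk
    · exact ⟨0, Or.inr h⟩
  have hmeas : ∀ k, MeasurableSet {t | ∀ m, ψ m t ≤ ψ k t + 1} := by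
    intro k
    have e : {t | ∀ m, ψ m t ≤ ψ k t + 1} = ⋂ m, {t | ψ m t ≤ ψ k t + 1} := by ext; simp
    rw [e]
    exact MeasurableSet.iInter fun m => measurableSet_le (hψ m) ((hψ k).add_const 1)
  refine ⟨fun t => Nat.find (hp t), measurable_find hp fun k => ?_, ?_⟩
  · refine (hmeas k).union (MeasurableSet.compl ?_)
    have e : {t | ∃ k, ∀ m, ψ m t ≤ ψ k t + 1} = ⋃ k, {t | ∀ m, ψ m t ≤ ψ k t + 1} := by
      ext; simp
    have h := MeasurableSet.iUnion hmeas
    rw [← e] at h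
    exact h
  · have he : ∀ᵐ t ∂μ, ∀ n, φ n t = ψ n t := ae_all_iff.2 fun n => (hφ n).ae_eq_mk
    filter_upwards [hb, he] with t hbt het
    have hex : ∃ k, ∀ m, ψ m t ≤ ψ k t + 1 := by
      obtain ⟨k, hk⟩ := exists_lt_of_lt_ciSup (sub_one_lt (⨆ n, φ n t))
      refine ⟨k, fun m => ?_⟩
      rw [← het, ← het]
      linarith [le_ciSup hbt m]
    rcases Nat.find_spec (hp t) with h | h
    · intro m
      rw [het, het]
      exact h m
    · exact absurd hex h

variable {Y : Type*} [NormedAddCommGroup Y] [InnerProductSpace ℝ Y] [CompleteSpace Y]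

/-- A weakly measurable function with values in a separable Hilbert space is measurable. -/
theorem aestronglyMeasurable_of_inner [TopologicalSpace.SeparableSpace Y] {f : X → Y}
    (hf : ∀ y : Y, AEStronglyMeasurable (fun t => ⟪y, f t⟫) μ) : AEStronglyMeasurable f μ := by
  obtain ⟨w, b, hb⟩ := exists_hilbertBasis ℝ Y
  have hw : w.Countable := by
    -- Distinct orthonormal vectors are at distance `√2 > 1`, and a separable space has only
    -- countably many disjoint nonempty open sets.
    refine (?_ : w.PairwiseDisjoint fun y => Metric.ball y (1 / 2)).countable_of_isOpen
      (fun _ _ => Metric.isOpen_ball) fun y _ => ⟨y, Metric.mem_ball_self (by norm_num)⟩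
    intro y hy z hz hne
    refine Metric.ball_disjoint_ball ?_
    have ho := b.orthonormal
    have h1 : ∀ i : w, ‖(i : Y)‖ = 1 := fun i => by
      have := ho.1 i; rwa [hb] at this
    have h2 : ⟪y, z⟫ = 0 := by
      have := ho.2 (i := ⟨y, hy⟩) (j := ⟨z, hz⟩) (by simpa using hne)
      rwa [hb] at this
    have h3 := norm_sub_sq_real y z
    rw [h2, h1 ⟨y, hy⟩, h1 ⟨z, hz⟩] at h3
    rw [dist_eq_norm]
    nlinarith [norm_nonneg (y - z)]
  have := hw.to_subtype
  refine aestronglyMeasurable_of_tendsto_ae (atTop : Filter (Finset w))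
    (f := fun s t => ∑ i ∈ s, ⟪b i, f t⟫ • b i) (fun s => ?_) (Eventually.of_forall fun t => ?_)
  · exact Finset.aestronglyMeasurable_fun_sum _ fun i _ => (hf (b i)).smul_const _
  · have := b.hasSum_repr (f t)
    simp only [b.repr_apply_apply] at this
    exact this

/-- The derivative along a measurable function of a Carathéodory function is (strongly)
measurable. -/
theorem aestronglyMeasurable_fderiv_apply {V W : Type*} [NormedAddCommGroup V] [NormedSpace ℝ V]
    [NormedAddCommGroup W] [NormedSpace ℝ W] {F : X → V → W} {G : X → V → V →L[ℝ] W}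
    (hF : ∀ y, AEStronglyMeasurable (fun t => F t y) μ)
    (hG : ∀ᵐ t ∂μ, ∀ y, HasFDerivAt (F t) (G t y) y)
    {x h : X → V} (hx : AEStronglyMeasurable x μ) (hh : AEStronglyMeasurable h μ) :
    AEStronglyMeasurable (fun t => G t (x t) (h t)) μ := by
  have hc : ∀ᵐ t ∂μ, Continuous (F t) := hG.mono fun t ht =>
    continuous_iff_continuousAt.2 fun y => (ht y).continuousAt
  refine aestronglyMeasurable_of_tendsto_ae (atTop : Filter ℕ)
    (f := fun n t => ((n : ℝ) + 1) • (F t (x t + ((n : ℝ) + 1)⁻¹ • h t) - F t (x t)))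
    (fun n => ?_) ?_
  · exact ((aestronglyMeasurable_caratheodory hF hc (hx.add (hh.const_smul _))).sub
      (aestronglyMeasurable_caratheodory hF hc hx)).const_smul _
  · filter_upwards [hG] with t ht
    have h1 : Tendsto (fun n : ℕ => (n : ℝ) + 1) atTop atTop :=
      tendsto_natCast_atTop_atTop.atTop_add tendsto_const_nhds
    exact ((ht (x t)).lim_real (h t)).comp h1

theorem aestronglyMeasurable_adjoint_fderiv_apply [TopologicalSpace.SeparableSpace Y]
    {F : X → Y → Y} {G : X → Y → Y →L[ℝ] Y}
    (hF : ∀ y, AEStronglyMeasurable (fun t => F t y) μ)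
    (hG : ∀ᵐ t ∂μ, ∀ y, HasFDerivAt (F t) (G t y) y)
    {x u : X → Y} (hx : AEStronglyMeasurable x μ) (hu : AEStronglyMeasurable u μ) :
    AEStronglyMeasurable (fun t => ContinuousLinearMap.adjoint (G t (x t)) (u t)) μ := by
  refine aestronglyMeasurable_of_inner fun y => ?_
  simp only [ContinuousLinearMap.adjoint_inner_right]
  exact (aestronglyMeasurable_fderiv_apply hF hG hx aestronglyMeasurable_const).inner hu

/-- A square integrable majorant of the derivative along a segment of square integrable
functions. -/
theorem exists_memLp_bound_segment [IsFiniteMeasure μ] {V W : Type*} [NormedAddCommGroup V]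
    [NormedSpace ℝ V] [NormedAddCommGroup W] {G : X → V → W}
    (hc : ∀ᵐ t ∂μ, Continuous (G t))
    (hG : ∀ x : X → V, MemLp x 2 μ → MemLp (fun t => ‖G t (x t)‖) 2 μ)
    {x h : X → V} (hx : MemLp x 2 μ) (hh : MemLp h 2 μ) :
    ∃ g : X → ℝ, MemLp g 2 μ ∧ ∀ᵐ t ∂μ, ∀ τ ∈ Icc (0 : ℝ) 1, ‖G t (x t + τ • h t)‖ ≤ g t := by
  let θ : ℕ → Icc (0 : ℝ) 1 := TopologicalSpace.denseSeq _
  have hθ : DenseRange θ := TopologicalSpace.denseRange_denseSeq _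
  have hcont : ∀ᵐ t ∂μ, Continuous fun τ : Icc (0 : ℝ) 1 => ‖G t (x t + (τ : ℝ) • h t)‖ :=
    hc.mono fun t ht => (ht.comp (by fun_prop)).norm
  obtain ⟨N, hN, hmax⟩ := exists_measurable_almost_max (μ := μ)
    (φ := fun n t => ‖G t (x t + (θ n : ℝ) • h t)‖)
    (fun n => (hG _ (hx.add (hh.const_smul (θ n : ℝ)))).1)
    (hcont.mono fun t ht => (isCompact_range ht).bddAbove.mono (by
      rintro _ ⟨n, rfl⟩
      exact ⟨θ n, rfl⟩))
  -- The almost maximizing point of the segment is itself an L² function of `t`, so `hG` applies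
  -- along it; adding 1 covers the slack in the selection.
  have hm : MemLp (fun t => (θ (N t) : ℝ) • h t) 2 μ := by
    have h1 : Measurable fun t => (θ (N t) : ℝ) :=
      (measurable_from_nat (f := fun n => (θ n : ℝ))).comp hN
    refine hh.mono (h1.aestronglyMeasurable.smul hh.1) (Eventually.of_forall fun t => ?_)
    rw [norm_smul, Real.norm_of_nonneg (θ (N t)).2.1]
    exact mul_le_of_le_one_left (norm_nonneg _) (θ (N t)).2.2
  refine ⟨_, (hG _ (hx.add hm)).add (memLp_const 1), ?_⟩
  filter_upwards [hcont, hmax] with t h1 h2 τ hτ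
  exact hθ.induction_on (p := fun τ : Icc (0 : ℝ) 1 => ‖G t (x t + (τ : ℝ) • h t)‖ ≤ _) ⟨τ, hτ⟩
    (isClosed_le h1 continuous_const) h2

theorem norm_sub_le_of_segment_bound {V W : Type*} [NormedAddCommGroup V]
    [NormedSpace ℝ V] [NormedAddCommGroup W] [NormedSpace ℝ W] {F : V → W} {G : V → V →L[ℝ] W}
    (hG : ∀ y, HasFDerivAt F (G y) y) {x h : V} {C : ℝ}
    (hb : ∀ τ ∈ Icc (0 : ℝ) 1, ‖G (x + τ • h)‖ ≤ C) {ε : ℝ} (hε : ε ∈ Icc (0 : ℝ) 1) :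
    ‖F (x + ε • h) - F x‖ ≤ C * ‖h‖ * ε := by
  have := norm_image_sub_le_of_norm_deriv_le_segment' (a := 0) (b := 1)
    (f := fun τ : ℝ => F (x + τ • h)) (f' := fun τ => G (x + τ • h) h) (C := C * ‖h‖)
    (fun τ _ => by
      have h1 : HasDerivAt (fun τ : ℝ => x + τ • h) h τ := by
        simpa using ((hasDerivAt_id τ).smul_const h).const_add x
      exact ((hG _).comp_hasDerivAt τ h1).hasDerivWithinAt)
    (fun τ hτ => (G _).le_of_opNorm_le (hb τ ⟨hτ.1, hτ.2.le⟩) h) ε hε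
  simpa using this

end Measurability

/-- A Hilbert space on which a strongly continuous semigroup of compact operators acts is
separable. -/
theorem IsC0Semigroup.separableSpace {Y : Type*} [NormedAddCommGroup Y] [InnerProductSpace ℝ Y]
    {S : ℝ → Y →L[ℝ] Y} (hS : IsC0Semigroup S) {a : ℝ} (ha : 0 < a)
    (hc : ∀ t : ℝ, 0 < t → t ≤ a → IsCompactOperator (S t)) :
    TopologicalSpace.SeparableSpace Y := by
  let r : ℕ → ℝ := fun n => a / ((n : ℝ) + 1)
  have hr : ∀ n, 0 < r n := fun n => by positivity
  have hra : ∀ n, r n ≤ a := fun n => div_le_self ha.le (by linarith [n.cast_nonneg (α := ℝ)])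
  -- The union of these compact sets is separable, and it is dense because `S (r n) y → y`.
  have hsep : TopologicalSpace.IsSeparable
      (⋃ n : ℕ, ⋃ k : ℕ, closure (S (r n) '' Metric.closedBall 0 (k : ℝ))) :=
    .iUnion fun n => .iUnion fun k =>
      ((hc (r n) (hr n) (hra n)).isCompact_closure_image_closedBall k).isSeparable
  have huniv : closure (⋃ n : ℕ, ⋃ k : ℕ, closure (S (r n) '' Metric.closedBall 0 (k : ℝ))) =
      univ := by
    refine eq_univ_of_forall fun y => ?_
    have h1 : Tendsto r atTop (𝓝[≥] 0) := by
      refine tendsto_nhdsWithin_iff.2 ⟨?_, Eventually.of_forall fun n => (hr n).le⟩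
      have := tendsto_one_div_add_atTop_nhds_zero_nat (𝕜 := ℝ)
      simpa [r, div_eq_mul_inv] using this.const_mul a
    have h2 := (hS.strongly_continuous y 0 self_mem_Ici).tendsto.comp h1
    simp only [hS.zero] at h2
    refine mem_closure_of_tendsto h2 (Eventually.of_forall fun n => ?_)
    obtain ⟨k, hk⟩ := exists_nat_ge ‖y‖
    refine mem_iUnion.2 ⟨n, mem_iUnion.2 ⟨k, subset_closure ⟨y, ?_, rfl⟩⟩⟩
    simpa using hk
  have := hsep.closure
  rw [huniv] at this
  exact TopologicalSpace.isSeparable_univ_iff.1 this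

/-! ### First variation of the cost and the adjoint state. -/

section

variable {Y : Type*} [NormedAddCommGroup Y] [InnerProductSpace ℝ Y]

theorem ContinuousOn.isL2 {V : Type*} [NormedAddCommGroup V] {a : ℝ} {x : ℝ → V} (hx : ContinuousOn x (Icc 0 a)) : IsL2 a x := by
  obtain ⟨C, hC⟩ := isCompact_Icc.exists_bound_of_continuousOn hx
  refine MemLp.of_bound (hx.aestronglyMeasurable measurableSet_Icc) C ?_
  filter_upwards [ae_restrict_mem measurableSet_Icc] with t ht using hC t ht

theorem IsL2.integrable {V : Type*} [NormedAddCommGroup V] {a : ℝ} {u : ℝ → V} (hu : IsL2 a u) :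
    Integrable u (volume.restrict (Icc 0 a)) :=
  MemLp.integrable one_le_two hu

theorem IsL2.integrable_norm_mul {V W : Type*} [NormedAddCommGroup V] [NormedAddCommGroup W]
    {a : ℝ} {u : ℝ → V} {v : ℝ → W} (hu : IsL2 a u) (hv : IsL2 a v) :
    Integrable (fun t => ‖u t‖ * ‖v t‖) (volume.restrict (Icc 0 a)) :=
  (MemLp.norm hu).integrable_mul (MemLp.norm hv)

theorem IsL2.integrable_inner {a : ℝ} {u v : ℝ → Y} (hu : IsL2 a u) (hv : IsL2 a v) :
    Integrable (fun t => ⟪u t, v t⟫) (volume.restrict (Icc 0 a)) :=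
  (hu.integrable_norm_mul hv).mono' (hu.1.inner hv.1)
    (Eventually.of_forall fun _ => norm_inner_le_norm _ _)

theorem IsL2.integrable_norm_sq {V : Type*} [NormedAddCommGroup V] {a : ℝ} {u : ℝ → V}
    (hu : IsL2 a u) : Integrable (fun t => ‖u t‖ ^ 2) (volume.restrict (Icc 0 a)) :=
  (hu.integrable_norm_mul hu).congr (Eventually.of_forall fun _ => (sq _).symm)

theorem quadraticCost_eq {a : ℝ} (ha : 0 ≤ a) (u x : ℝ → Y) :
    quadraticCost a u x = ∫ t in Icc 0 a, (‖u t‖ ^ 2 + ‖x t‖ ^ 2) := by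
  simp only [quadraticCost, real_inner_self_eq_norm_sq]
  exact intervalIntegral_eq_setIntegral_Icc ha _

theorem isL2_superposition {V : Type*} [NormedAddCommGroup V] {a : ℝ} {F : ℝ → V → V}
    (hF : ∀ y, AEStronglyMeasurable (fun t => F t y) (volume.restrict (Icc 0 a)))
    (hFc : ∀ᵐ t ∂(volume.restrict (Icc 0 a)), Continuous (F t))
    {α : ℝ → ℝ} {b : ℝ} (hα : IsL2 a α) (hb : ∀ t ∈ Icc 0 a, ∀ y, ‖F t y‖ ≤ α t + b * ‖y‖)
    {x : ℝ → V} (hx : IsL2 a x) : IsL2 a (fun t => F t (x t)) := by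
  have h : MemLp (fun t => α t + b * ‖x t‖) 2 (volume.restrict (Icc 0 a)) :=
    MemLp.add hα (MemLp.const_mul (MemLp.norm hx) b)
  refine MemLp.mono h (aestronglyMeasurable_caratheodory hF hFc hx.1) ?_
  filter_upwards [ae_restrict_mem measurableSet_Icc] with t ht
  exact (hb t ht _).trans (le_abs_self _)

theorem IsMildSolution.add_smul_mildConv {S : ℝ → Y →L[ℝ] Y} (hS : IsContractionFamily S) {a : ℝ}
    {x₀ : Y} {f x w : ℝ → Y} (hx : IsMildSolution a S x₀ f x) (hw : IsL2 a w) (ε : ℝ) :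
    IsMildSolution a S x₀ (fun t => f t + ε • w t) (fun t => x t + ε • mildConv S w t) := by
  refine ⟨hx.1.add ((hS.continuousOn_mildConv hw.integrable).const_smul ε), fun t ht => ?_⟩
  have h1 := (hx.2 t ht).1
  have h2 := hS.intervalIntegrable ht.1
    (hw.integrable.mono_measure (Measure.restrict_mono (Icc_subset_Icc_right ht.2) le_rfl))
  simp only [map_add, map_smul]
  refine ⟨h1.add (h2.smul ε), ?_⟩
  have h3 := intervalIntegral.integral_add h1 (h2.smul ε)
  simp only [Pi.smul_apply] at h3
  rw [h3, intervalIntegral.integral_smul, (hx.2 t ht).2, add_assoc]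
  rfl

/-- The first variation of the cost at an optimal pair, in the direction of the perturbation
`x + ε ∫₀ᵗ S(t - s) w(s) ds` of the state. -/
theorem IsOptimalPair.first_variation_nonneg {S : ℝ → Y →L[ℝ] Y} (hS : IsContractionFamily S)
    {a : ℝ} (ha : 0 < a) {x₀ : Y} {F : ℝ → Y → Y} {G : ℝ → Y → Y →L[ℝ] Y}
    (hF : ∀ y, AEStronglyMeasurable (fun t => F t y) (volume.restrict (Icc 0 a)))
    {α : ℝ → ℝ} {b : ℝ} (hα : IsL2 a α) (hb : ∀ t ∈ Icc 0 a, ∀ y, ‖F t y‖ ≤ α t + b * ‖y‖)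
    (hG : ∀ᵐ t ∂(volume.restrict (Icc 0 a)),
      (∀ y : Y, HasFDerivAt (F t) (G t y) y) ∧ Continuous (G t))
    (hGint : ∀ x : ℝ → Y, IsL2 a x → IsL2 a (fun t => ‖G t (x t)‖))
    {u x w : ℝ → Y} (hux : IsOptimalPair a S F x₀ u x) (hw : IsL2 a w) :
    0 ≤ ∫ t in Icc 0 a, (2 * ⟪u t, w t - G t (x t) (mildConv S w t)⟫ +
      2 * ⟪x t, mildConv S w t⟫) := by
  set μ := volume.restrict (Icc 0 a) with hμ
  set h := mildConv S w with hh
  have hFc : ∀ᵐ t ∂μ, Continuous (F t) := hG.mono fun t ht =>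
    continuous_iff_continuousAt.2 fun y => (ht.1 y).continuousAt
  have hu : IsL2 a u := hux.1.1
  have hx : IsL2 a x := hux.1.2.1.isL2
  have hhc : ContinuousOn h (Icc 0 a) := hS.continuousOn_mildConv hw.integrable
  have hh2 : IsL2 a h := hhc.isL2
  obtain ⟨C, hC⟩ := isCompact_Icc.exists_bound_of_continuousOn hhc
  obtain ⟨g, hg, hgb⟩ := exists_memLp_bound_segment (μ := μ) (G := G) (hG.mono fun t ht => ht.2)
    hGint hx hh2
  let c : ℕ → ℝ := fun n => (n : ℝ) + 1
  have hc : ∀ n, 0 < c n := fun n => by positivity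
  have hc1 : ∀ n, (c n)⁻¹ ≤ 1 := fun n =>
    inv_le_one_of_one_le₀ (by simp [c])
  -- With `ε = (c n)⁻¹`, this is the control increment that makes `x + ε h` exactly the state of `u
  -- + ε q`.
  let q : ℕ → ℝ → Y := fun n t => w t - c n • (F t (x t + (c n)⁻¹ • h t) - F t (x t))
  let xε : ℕ → ℝ → Y := fun n t => x t + (c n)⁻¹ • h t
  have hxε : ∀ n, IsL2 a (xε n) := fun n => MemLp.add hx (MemLp.const_smul hh2 _)
  have hq : ∀ n, IsL2 a (q n) := fun n => MemLp.sub hw (MemLp.const_smul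
    (MemLp.sub (isL2_superposition hF hFc hα hb (hxε n))
      (isL2_superposition hF hFc hα hb hx)) _)
  have hadm : ∀ n, IsAdmissible a S F x₀ (fun t => u t + (c n)⁻¹ • q n t) (xε n) := by
    intro n
    refine ⟨MemLp.add hu (MemLp.const_smul (hq n) _), ?_⟩
    have h1 := hux.1.2.add_smul_mildConv hS hw (c n)⁻¹
    have e : (fun t => F t (x t) + u t + (c n)⁻¹ • w t) =
        fun t => F t (xε n t) + (u t + (c n)⁻¹ • q n t) := by
      ext t
      simp only [q, xε, smul_sub, inv_smul_smul₀ (hc n).ne']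
      abel
    rwa [e] at h1
  -- Integrand of the cost difference divided by `ε`.
  let I : ℕ → ℝ → ℝ := fun n t => 2 * ⟪u t, q n t⟫ + 2 * ⟪x t, h t⟫ +
    (c n)⁻¹ * (‖q n t‖ ^ 2 + ‖h t‖ ^ 2)
  have hIint : ∀ n, Integrable (I n) μ := fun n =>
    (((hu.integrable_inner (hq n)).const_mul 2).add ((hx.integrable_inner hh2).const_mul 2)).add
      (((hq n).integrable_norm_sq.add hh2.integrable_norm_sq).const_mul _)
  have hI : ∀ n, 0 ≤ ∫ t, I n t ∂μ := by
    intro n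
    have h1 := hux.2 _ _ (hadm n)
    rw [quadraticCost_eq ha.le, quadraticCost_eq ha.le, ← sub_nonneg] at h1
    have hnew : Integrable (fun t => ‖u t + (c n)⁻¹ • q n t‖ ^ 2 + ‖xε n t‖ ^ 2) μ :=
      (hadm n).1.integrable_norm_sq.add (hxε n).integrable_norm_sq
    have hold : Integrable (fun t => ‖u t‖ ^ 2 + ‖x t‖ ^ 2) μ :=
      hu.integrable_norm_sq.add hx.integrable_norm_sq
    rw [← integral_sub hnew hold] at h1
    have e : ∀ t, ‖u t + (c n)⁻¹ • q n t‖ ^ 2 + ‖xε n t‖ ^ 2 - (‖u t‖ ^ 2 + ‖x t‖ ^ 2) =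
        (c n)⁻¹ * I n t := by
      intro t
      simp only [xε, norm_add_sq_real, inner_smul_right, norm_smul, mul_pow, Real.norm_eq_abs,
        sq_abs, I]
      ring
    simp only [e] at h1
    rw [integral_const_mul] at h1
    exact nonneg_of_mul_nonneg_right h1 (inv_pos.2 (hc n))
  have hqb : ∀ᵐ t ∂μ, ∀ n, ‖q n t‖ ≤ ‖w t‖ + C * g t := by
    filter_upwards [hG, hgb, ae_restrict_mem measurableSet_Icc] with t ht1 ht2 ht3 n
    refine (norm_sub_le _ _).trans (add_le_add_right ?_ _)
    have h1 := norm_sub_le_of_segment_bound ht1.1 ht2 ⟨(inv_pos.2 (hc n)).le, hc1 n⟩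
    have hg0 : 0 ≤ g t := (norm_nonneg _).trans (ht2 0 ⟨le_rfl, zero_le_one⟩)
    rw [norm_smul, Real.norm_of_nonneg (hc n).le]
    calc c n * ‖F t (x t + (c n)⁻¹ • h t) - F t (x t)‖
        ≤ c n * (g t * ‖h t‖ * (c n)⁻¹) := mul_le_mul_of_nonneg_left h1 (hc n).le
      _ = g t * ‖h t‖ := by field_simp [(hc n).ne']
      _ ≤ g t * C := mul_le_mul_of_nonneg_left (hC t ht3) hg0
      _ = C * g t := mul_comm _ _
  have hQ : IsL2 a (fun t => ‖w t‖ + C * g t) := MemLp.add (MemLp.norm hw) (hg.const_mul C)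
  let B : ℝ → ℝ := fun t => 2 * (‖u t‖ * ‖‖w t‖ + C * g t‖) + 2 * (‖x t‖ * ‖h t‖) +
    (‖‖w t‖ + C * g t‖ ^ 2 + ‖h t‖ ^ 2)
  have hB : Integrable B μ :=
    (((hu.integrable_norm_mul hQ).const_mul 2).add ((hx.integrable_norm_mul hh2).const_mul 2)).add
      (hQ.integrable_norm_sq.add hh2.integrable_norm_sq)
  have hlim : Tendsto (fun n => ∫ t, I n t ∂μ) atTop
      (𝓝 (∫ t, (2 * ⟪u t, w t - G t (x t) (h t)⟫ + 2 * ⟪x t, h t⟫) ∂μ)) := by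
    refine tendsto_integral_of_dominated_convergence B (fun n => (hIint n).1) hB ?_ ?_
    · intro n
      filter_upwards [hqb] with t ht
      have h1 : ‖q n t‖ ≤ ‖‖w t‖ + C * g t‖ := (ht n).trans (le_abs_self _)
      have h2 : |⟪u t, q n t⟫| ≤ ‖u t‖ * ‖‖w t‖ + C * g t‖ :=
        (abs_real_inner_le_norm _ _).trans (mul_le_mul_of_nonneg_left h1 (norm_nonneg _))
      have h3 : |⟪x t, h t⟫| ≤ ‖x t‖ * ‖h t‖ := abs_real_inner_le_norm _ _
      have h4 : ‖q n t‖ ^ 2 ≤ ‖‖w t‖ + C * g t‖ ^ 2 := pow_le_pow_left₀ (norm_nonneg _) h1 2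
      have h5 : (c n)⁻¹ * (‖q n t‖ ^ 2 + ‖h t‖ ^ 2) ≤ ‖‖w t‖ + C * g t‖ ^ 2 + ‖h t‖ ^ 2 :=
        (mul_le_of_le_one_left (by positivity) (hc1 n)).trans (by linarith)
      have h6 : 0 ≤ (c n)⁻¹ * (‖q n t‖ ^ 2 + ‖h t‖ ^ 2) :=
        mul_nonneg (inv_pos.2 (hc n)).le (by positivity)
      rw [abs_le] at h2 h3
      rw [Real.norm_eq_abs, abs_le]
      simp only [I, B]
      constructor <;> linarith [h2.1, h2.2, h3.1, h3.2]
    · filter_upwards [hG] with t ht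
      have hctop : Tendsto c atTop atTop :=
        tendsto_natCast_atTop_atTop.atTop_add tendsto_const_nhds
      have h1 : Tendsto (fun n => q n t) atTop (𝓝 (w t - G t (x t) (h t))) :=
        tendsto_const_nhds.sub (((ht.1 (x t)).lim_real (h t)).comp hctop)
      have h2 := (((tendsto_const_nhds (x := u t)).inner (𝕜 := ℝ) h1).const_mul 2).add_const
        (2 * ⟪x t, h t⟫)
      have h3 := (tendsto_inv_atTop_zero.comp hctop).mul ((h1.norm.pow 2).add_const (‖h t‖ ^ 2))
      have h4 := h2.add h3
      rw [zero_mul, add_zero] at h4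
      exact h4
  exact ge_of_tendsto' hlim hI

theorem mildConv_neg (S : ℝ → Y →L[ℝ] Y) (w : ℝ → Y) (t : ℝ) :
    mildConv S (fun s => -w s) t = -mildConv S w t := by
  simp [mildConv]

theorem integrable_adjoint_fderiv_apply [CompleteSpace Y] [TopologicalSpace.SeparableSpace Y]
    {a : ℝ} {F : ℝ → Y → Y} {G : ℝ → Y → Y →L[ℝ] Y}
    (hF : ∀ y, AEStronglyMeasurable (fun t => F t y) (volume.restrict (Icc 0 a)))
    (hG : ∀ᵐ t ∂(volume.restrict (Icc 0 a)), ∀ y : Y, HasFDerivAt (F t) (G t y) y)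
    (hGint : ∀ x : ℝ → Y, IsL2 a x → IsL2 a (fun t => ‖G t (x t)‖))
    {u x : ℝ → Y} (hu : IsL2 a u) (hx : IsL2 a x) :
    Integrable (fun t => ContinuousLinearMap.adjoint (G t (x t)) (u t))
      (volume.restrict (Icc 0 a)) := by
  refine ((hGint x hx).integrable_norm_mul hu).mono'
    (aestronglyMeasurable_adjoint_fderiv_apply hF hG hx.1 hu.1) (Eventually.of_forall fun t => ?_)
  have := (ContinuousLinearMap.adjoint (G t (x t))).le_opNorm (u t)
  rw [LinearIsometryEquiv.norm_map] at this
  rwa [norm_norm]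

/-- The optimal control solves the adjoint equation. -/
theorem IsOptimalPair.ae_eq_adjoint_state [CompleteSpace Y] {A : Y →ₗ.[ℝ] Y}
    {S : ℝ → Y →L[ℝ] Y} (hAS : IsGenerator A S) (hA : ∀ y : A.domain, ⟪A y, (y : Y)⟫ ≤ 0)
    [TopologicalSpace.SeparableSpace Y]
    {a : ℝ} (ha : 0 < a) {x₀ : Y} {F : ℝ → Y → Y} {G : ℝ → Y → Y →L[ℝ] Y}
    (hF : ∀ y, AEStronglyMeasurable (fun t => F t y) (volume.restrict (Icc 0 a)))
    {α : ℝ → ℝ} {b : ℝ} (hα : IsL2 a α) (hb : ∀ t ∈ Icc 0 a, ∀ y, ‖F t y‖ ≤ α t + b * ‖y‖)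
    (hG : ∀ᵐ t ∂(volume.restrict (Icc 0 a)),
      (∀ y : Y, HasFDerivAt (F t) (G t y) y) ∧ Continuous (G t))
    (hGint : ∀ x : ℝ → Y, IsL2 a x → IsL2 a (fun t => ‖G t (x t)‖))
    {u x : ℝ → Y} (hux : IsOptimalPair a S F x₀ u x) :
    (fun s => ∫ t in s..a, ContinuousLinearMap.adjoint (S (t - s))
        (ContinuousLinearMap.adjoint (G t (x t)) (u t) - x t))
      =ᵐ[volume.restrict (Icc 0 a)] u := by
  have hS := hAS.isContractionFamily hA
  have hu : IsL2 a u := hux.1.1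
  have hx : IsL2 a x := hux.1.2.1.isL2
  let f : ℝ → Y := fun t => ContinuousLinearMap.adjoint (G t (x t)) (u t) - x t
  let p : ℝ → Y := fun s => ∫ t in s..a, ContinuousLinearMap.adjoint (S (t - s)) (f t)
  have hf : Integrable f (volume.restrict (Icc 0 a)) :=
    (integrable_adjoint_fderiv_apply hF (hG.mono fun t ht => ht.1) hGint hu hx).sub hx.integrable
  have hp := isBackwardMildSolution_integral hAS hA ha hf
  have hp2 : IsL2 a p := hp.1.isL2
  have hEL : ∀ w : ℝ → Y, IsL2 a w →
      ∫ t in Icc 0 a, ⟪u t, w t⟫ = ∫ t in Icc 0 a, ⟪p t, w t⟫ := by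
    intro w hw
    set h := mildConv S w with hh
    have hhc : ContinuousOn h (Icc 0 a) := hS.continuousOn_mildConv hw.integrable
    have hfh : Integrable (fun t => ⟪f t, h t⟫) (volume.restrict (Icc 0 a)) := by
      obtain ⟨C, hC⟩ := isCompact_Icc.exists_bound_of_continuousOn hhc
      refine (hf.norm.mul_const C).mono' (hf.1.inner hhc.isL2.1) ?_
      filter_upwards [ae_restrict_mem measurableSet_Icc] with t ht
      exact (norm_inner_le_norm _ _).trans (mul_le_mul_of_nonneg_left (hC t ht) (norm_nonneg _))
    -- With `f = G* u - x` the variation is linear in `w`; the inequalities for `w` and `-w`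
    -- together force it to vanish.
    have e : ∀ t, 2 * ⟪u t, w t - G t (x t) (h t)⟫ + 2 * ⟪x t, h t⟫ =
        2 * (⟪u t, w t⟫ - ⟪f t, h t⟫) := by
      intro t
      simp only [f, inner_sub_right, inner_sub_left, ContinuousLinearMap.adjoint_inner_left]
      ring
    have h1 := hux.first_variation_nonneg hS ha hF hα hb hG hGint hw
    have h2 := hux.first_variation_nonneg hS ha hF hα hb hG hGint (w := fun t => -w t)
      (MemLp.neg hw)
    have e2 : ∀ t, 2 * ⟪u t, -w t - G t (x t) (mildConv S (fun s => -w s) t)⟫ +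
        2 * ⟪x t, mildConv S (fun s => -w s) t⟫ = -(2 * (⟪u t, w t⟫ - ⟪f t, h t⟫)) := by
      intro t
      rw [← e t, mildConv_neg, map_neg, inner_neg_right, ← neg_sub', inner_neg_right]
      ring
    simp only [e2] at h2
    simp only [← hh, e] at h1
    rw [integral_neg] at h2
    rw [integral_const_mul, integral_sub (hu.integrable_inner hw) hfh] at h1 h2
    have h3 := hS.integral_inner_mildConv hw.integrable hf
    have h4 : ∫ s in Icc 0 a, ∫ t in s..a, ⟪f t, S (t - s) (w s)⟫ =
        ∫ s in Icc 0 a, ⟪p s, w s⟫ := by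
      refine setIntegral_congr_fun measurableSet_Icc fun s hs => ?_
      have := (innerSL ℝ (w s)).intervalIntegral_comp_comm (hp.2 s hs).1
      simp only [innerSL_apply_apply] at this
      simp only [p]
      rw [real_inner_comm]
      refine Eq.trans ?_ this
      refine intervalIntegral.integral_congr fun t _ => ?_
      simp only [ContinuousLinearMap.adjoint_inner_right]
      exact real_inner_comm _ _
    linarith
  -- Testing the identity with `w = p - u` itself gives `∫ ‖p - u‖² = 0`.
  have hd : IsL2 a (fun t => p t - u t) := MemLp.sub hp2 hu
  have h0 : ∫ t in Icc 0 a, ‖p t - u t‖ ^ 2 = 0 := by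
    have h1 := hEL _ hd
    rw [eq_comm, ← sub_eq_zero, ← integral_sub (hp2.integrable_inner hd)
      (hu.integrable_inner hd)] at h1
    refine Eq.trans (integral_congr_ae ?_) h1
    refine (Eventually.of_forall fun t => ?_)
    simp only
    rw [← inner_sub_left, real_inner_self_eq_norm_sq]
  rw [integral_eq_zero_iff_of_nonneg (fun t => by positivity) hd.integrable_norm_sq] at h0
  filter_upwards [h0] with t ht
  have h1 : ‖p t - u t‖ ^ 2 = 0 := ht
  exact sub_eq_zero.1 (norm_eq_zero.1 ((pow_eq_zero_iff two_ne_zero).1 h1))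

end

/-! ### Weak compactness and existence of an optimal pair. -/

/-- Bounded sequences in a Hilbert space have weakly convergent subsequences. -/
theorem exists_subseq_tendsto_inner {H : Type*} [NormedAddCommGroup H] [InnerProductSpace ℝ H]
    [CompleteSpace H] {w : ℕ → H} {C : ℝ} (hw : ∀ n, ‖w n‖ ≤ C) :
    ∃ (z : H) (φ : ℕ → ℕ), StrictMono φ ∧
      ∀ v, Tendsto (fun n => ⟪w (φ n), v⟫) atTop (𝓝 ⟪z, v⟫) := by
  -- The closed span is separable, as sequential Banach–Alaoglu requires; testing against `v` only
  -- sees its projection to `K`.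
  let K : Submodule ℝ H := (Submodule.span ℝ (range w)).topologicalClosure
  have hmem : ∀ n, w n ∈ K := fun n =>
    Submodule.le_topologicalClosure _ (Submodule.subset_span ⟨n, rfl⟩)
  have hsep : TopologicalSpace.IsSeparable (K : Set H) :=
    ((countable_range w).isSeparable.span (R := ℝ)).closure
  have : TopologicalSpace.SeparableSpace K := hsep.separableSpace
  have : CompleteSpace K :=
    (Submodule.isClosed_topologicalClosure _).completeSpace_coe
  let k : ℕ → K := fun n => ⟨w n, hmem n⟩
  let L : ℕ → WeakDual ℝ K := fun n =>
    StrongDual.toWeakDual (InnerProductSpace.toDual ℝ K (k n))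
  obtain ⟨l, -, φ, hφ, hl⟩ := WeakDual.isSeqCompact_closedBall ℝ K (0 : StrongDual ℝ K) C
    (x := L) (fun n => by
      have h1 : ‖InnerProductSpace.toDual ℝ K (k n)‖ ≤ C := by
        rw [LinearIsometryEquiv.norm_map]; exact hw n
      have : InnerProductSpace.toDual ℝ K (k n) ∈ Metric.closedBall (0 : StrongDual ℝ K) C := by
        simpa using h1
      exact this)
  let z : K := (InnerProductSpace.toDual ℝ K).symm (WeakDual.toStrongDual l)
  refine ⟨z, φ, hφ, fun v => ?_⟩
  have h1 : Tendsto (fun n => L (φ n) (K.orthogonalProjectionOnto v)) atTop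
      (𝓝 (l (K.orthogonalProjectionOnto v))) :=
    ((WeakDual.eval_continuous (𝕜 := ℝ) (K.orthogonalProjectionOnto v)).tendsto l).comp hl
  have h2 : ∀ y : K, ⟪(y : H), v⟫ = ⟪y, K.orthogonalProjectionOnto v⟫ := fun y =>
    (Submodule.inner_orthogonalProjectionOnto_eq_of_mem_left y v).symm
  have h3 : l (K.orthogonalProjectionOnto v) = ⟪z, K.orthogonalProjectionOnto v⟫ := by
    rw [InnerProductSpace.toDual_symm_apply]; rfl
  rw [h2, ← h3]
  refine h1.congr fun n => ?_
  exact (h2 (k (φ n))).symm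

/-- A compact operator maps bounded weakly null sequences to null sequences. -/
theorem IsCompactOperator.tendsto_of_weakly_null {H : Type*} [NormedAddCommGroup H]
    [InnerProductSpace ℝ H] [CompleteSpace H] {K : H →L[ℝ] H} (hK : IsCompactOperator K)
    {z : ℕ → H} {C : ℝ} (hz : ∀ n, ‖z n‖ ≤ C)
    (hw : ∀ y, Tendsto (fun n => ⟪z n, y⟫) atTop (𝓝 0)) :
    Tendsto (fun n => K (z n)) atTop (𝓝 0) := by
  refine tendsto_of_subseq_tendsto fun ns hns => ?_
  have hc := (IsCompactOperator.isCompact_closure_image_closedBall (f := K.toLinearMap) hK C)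
  obtain ⟨k, -, φ, hφ, hk⟩ := hc.isSeqCompact (x := fun n => K (z (ns n))) fun n =>
    subset_closure ⟨z (ns n), by simpa using hz _, rfl⟩
  refine ⟨φ, ?_⟩
  have h0 : k = 0 := by
    refine ext_inner_right ℝ fun y => ?_
    have h1 : Tendsto (fun n => ⟪K (z (ns (φ n))), y⟫) atTop (𝓝 ⟪k, y⟫) :=
      hk.inner tendsto_const_nhds
    have h2 : Tendsto (fun n => ⟪z (ns (φ n)), ContinuousLinearMap.adjoint K y⟫) atTop (𝓝 0) :=
      (hw _).comp (hns.comp hφ.tendsto_atTop)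
    simp only [ContinuousLinearMap.adjoint_inner_right] at h2
    rw [inner_zero_left]
    exact tendsto_nhds_unique h1 h2
  rw [← h0]
  exact hk

section

variable {Y : Type*} [NormedAddCommGroup Y] [InnerProductSpace ℝ Y]

theorem exists_subseq_tendsto_integral_inner [CompleteSpace Y] {a C : ℝ} {w : ℕ → ℝ → Y}
    (hw : ∀ n, IsL2 a (w n)) (hC : ∀ n, ∫ t in Icc 0 a, ‖w n t‖ ^ 2 ≤ C) :
    ∃ (z : ℝ → Y) (φ : ℕ → ℕ), IsL2 a z ∧ StrictMono φ ∧ ∀ v, IsL2 a v →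
      Tendsto (fun n => ∫ t in Icc 0 a, ⟪w (φ n) t, v t⟫) atTop
        (𝓝 (∫ t in Icc 0 a, ⟪z t, v t⟫)) := by
  let W : ℕ → Lp Y 2 (volume.restrict (Icc 0 a)) := fun n => MemLp.toLp (w n) (hw n)
  have hW : ∀ n, ‖W n‖ ≤ √C := by
    intro n
    refine Real.le_sqrt_of_sq_le (le_trans (le_of_eq ?_) (hC n))
    rw [← real_inner_self_eq_norm_sq, L2.inner_def]
    refine integral_congr_ae ?_
    filter_upwards [MemLp.coeFn_toLp (hw n)] with t ht
    simp only [W, ht, real_inner_self_eq_norm_sq]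
  obtain ⟨z, φ, hφ, h⟩ := exists_subseq_tendsto_inner hW
  refine ⟨z, φ, Lp.memLp z, hφ, fun v hv => ?_⟩
  have h1 := h (MemLp.toLp v hv)
  simp only [L2.inner_def] at h1
  have e : ∫ t in Icc 0 a, ⟪z t, MemLp.toLp v hv t⟫ = ∫ t in Icc 0 a, ⟪z t, v t⟫ := by
    refine integral_congr_ae ?_
    filter_upwards [MemLp.coeFn_toLp hv] with t ht
    simp only [ht]
  rw [e] at h1
  refine h1.congr fun n => integral_congr_ae ?_
  filter_upwards [MemLp.coeFn_toLp hv, MemLp.coeFn_toLp (hw (φ n))] with t ht ht'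
  simp only [W, ht, ht']

theorem mildConv_sub {S : ℝ → Y →L[ℝ] Y} (hS : IsContractionFamily S) {t : ℝ} (ht : 0 ≤ t)
    {f g : ℝ → Y} (hf : Integrable f (volume.restrict (Icc 0 t)))
    (hg : Integrable g (volume.restrict (Icc 0 t))) :
    mildConv S (fun s => f s - g s) t = mildConv S f t - mildConv S g t := by
  simp only [mildConv, map_sub]
  exact intervalIntegral.integral_sub (hS.intervalIntegrable ht hf) (hS.intervalIntegrable ht hg)

theorem IsContractionFamily.inner_mildConv_eq [CompleteSpace Y] {S : ℝ → Y →L[ℝ] Y}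
    (hS : IsContractionFamily S) {a t : ℝ} (ht : t ∈ Icc 0 a) {f : ℝ → Y}
    (hf : Integrable f (volume.restrict (Icc 0 a))) (y : Y) :
    ⟪mildConv S f t, y⟫ = ∫ s in Icc 0 a,
      ⟪f s, (Iic t).indicator (fun s => ContinuousLinearMap.adjoint (S (max (t - s) 0)) y) s⟫ := by
  rw [IsContractionFamily.mildConv_eq S ht, real_inner_comm]
  have hi : Integrable ((Iic t).indicator (fun s => S (max (t - s) 0) (f s)))
      (volume.restrict (Icc 0 a)) :=
    (hS.integrable (r := fun s => t - s) (by fun_prop) hf).indicator measurableSet_Iic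
  refine ((innerSL ℝ y).integral_comp_comm hi).symm.trans ?_
  refine integral_congr_ae (Eventually.of_forall fun s => ?_)
  simp only [innerSL_apply_apply]
  by_cases h : s ∈ Iic t
  · rw [indicator_of_mem h, indicator_of_mem h, ContinuousLinearMap.adjoint_inner_right,
      real_inner_comm]
  · rw [indicator_of_notMem h, indicator_of_notMem h, inner_zero_right, inner_zero_right]

/-- Compactness of the semigroup turns weak convergence of the data into strong convergence of the
mild solutions. -/
theorem tendsto_mildConv_of_weakly_null [CompleteSpace Y] {S : ℝ → Y →L[ℝ] Y}
    (hS0 : IsC0Semigroup S) (hS : IsContractionFamily S)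
    (hS' : IsContractionFamily fun t => ContinuousLinearMap.adjoint (S t)) {a : ℝ}
    (hc : ∀ t : ℝ, 0 < t → t ≤ a → IsCompactOperator (S t)) {d : ℕ → ℝ → Y} {D : ℝ}
    (hd : ∀ n, IsL2 a (d n)) (hD : ∀ n, ∫ t in Icc 0 a, ‖d n t‖ ^ 2 ≤ D)
    (hw : ∀ v, IsL2 a v → Tendsto (fun n => ∫ t in Icc 0 a, ⟪d n t, v t⟫) atTop (𝓝 0))
    {t : ℝ} (ht : t ∈ Icc 0 a) : Tendsto (fun n => mildConv S (d n) t) atTop (𝓝 0) := by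
  rcases ht.1.eq_or_lt with rfl | ht0
  · simp [mildConv]
  have hD0 : 0 ≤ D := (integral_nonneg fun t => by positivity).trans (hD 0)
  -- Young's inequality takes the place of Cauchy–Schwarz in passing from L² bounds to L¹ bounds.
  have hyoung : ∀ (η r : ℝ), 0 < η → r ≤ η⁻¹ + η * r ^ 2 := by
    intro η r hη
    have h1 : 0 ≤ η⁻¹ * (1 - η * r) ^ 2 := by positivity
    have h2 : η⁻¹ * (1 - η * r) ^ 2 = η⁻¹ - 2 * r + η * r ^ 2 := by
      field_simp; ring
    have h3 : 0 ≤ η⁻¹ + η * r ^ 2 := by positivity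
    by_cases hr : 0 ≤ r <;> linarith
  -- the tail of the integral is uniformly small
  have htail : ∀ (η ε : ℝ), 0 < η → 0 < ε → ε ≤ t → ∀ n,
      ‖∫ s in (t - ε)..t, S (t - s) (d n s)‖ ≤ ε * η⁻¹ + η * D := by
    intro η ε hη hε hεt n
    rw [intervalIntegral_eq_setIntegral_Icc (by linarith)]
    have hsub : Icc (t - ε) t ⊆ Icc 0 a := Icc_subset_Icc (by linarith) ht.2
    have hsq : Integrable (fun s => ‖d n s‖ ^ 2) (volume.restrict (Icc (t - ε) t)) :=
      (hd n).integrable_norm_sq.mono_measure (Measure.restrict_mono hsub le_rfl)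
    have hi : Integrable (fun s => η⁻¹ + η * ‖d n s‖ ^ 2) (volume.restrict (Icc (t - ε) t)) :=
      (integrable_const _).add (hsq.const_mul η)
    refine (norm_integral_le_of_norm_le hi ?_).trans ?_
    · filter_upwards [ae_restrict_mem measurableSet_Icc] with s hs
      exact (hS.norm_le _ (sub_nonneg.2 hs.2) _).trans (hyoung η _ hη)
    · rw [integral_add (integrable_const _) (hsq.const_mul η), integral_const_mul]
      have h1 : ∫ s in Icc (t - ε) t, ‖d n s‖ ^ 2 ≤ D :=
        (setIntegral_mono_set (hd n).integrable_norm_sq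
          (Eventually.of_forall fun s => by positivity) hsub.eventuallyLE).trans (hD n)
      have h2 : ∫ _ in Icc (t - ε) t, η⁻¹ = ε * η⁻¹ := by
        simp [hε.le]
      rw [h2]
      exact add_le_add_right (mul_le_mul_of_nonneg_left h1 hη.le) _
  -- the rest is in the range of a compact operator
  have hhead : ∀ ε : ℝ, 0 < ε → ε ≤ t →
      Tendsto (fun n => S ε (mildConv S (d n) (t - ε))) atTop (𝓝 0) := by
    intro ε hε hεt
    have hmem : t - ε ∈ Icc 0 a := ⟨by linarith, by linarith [ht.2]⟩
    refine (hc ε hε (hεt.trans ht.2)).tendsto_of_weakly_null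
      (C := (∫ _ in Icc (0 : ℝ) a, (1 : ℝ)) + D) (fun n => ?_) fun y => ?_
    · refine (hS.norm_mildConv_le hmem (hd n).integrable).trans ?_
      refine (integral_mono (hd n).integrable.norm
        ((integrable_const (1 : ℝ)).add (hd n).integrable_norm_sq) fun s => ?_).trans ?_
      · simpa using hyoung 1 ‖d n s‖ one_pos
      · exact (integral_add (integrable_const (1 : ℝ)) (hd n).integrable_norm_sq).trans_le
          (add_le_add_right (hD n) _)
    · simp only [hS.inner_mildConv_eq hmem (hd _).integrable]
      refine hw _ (MemLp.of_bound ((hS'.aestronglyMeasurable (r := fun s => t - ε - s)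
        (by fun_prop) aestronglyMeasurable_const).indicator measurableSet_Iic) ‖y‖ ?_)
      exact Eventually.of_forall fun s =>
        (norm_indicator_le_norm_self _ _).trans (hS'.norm_le _ (le_max_right _ _) _)
  -- On `[0, t - ε]` the law `S (t - s) = S ε ∘ S (t - ε - s)` extracts the compact factor `S ε`.
  have hsplit : ∀ ε : ℝ, 0 < ε → ε ≤ t → ∀ n, mildConv S (d n) t =
      S ε (mildConv S (d n) (t - ε)) + ∫ s in (t - ε)..t, S (t - s) (d n s) := by
    intro ε hε hεt n
    have hint : ∀ τ ∈ Icc 0 a, Integrable (d n) (volume.restrict (Icc 0 τ)) := fun τ hτ =>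
      (hd n).integrable.mono_measure (Measure.restrict_mono (Icc_subset_Icc_right hτ.2) le_rfl)
    have h1 := hS.intervalIntegrable ht.1 (hint t ht)
    have h2 : t - ε ∈ Icc 0 t := ⟨by linarith, by linarith⟩
    have h2' : IntervalIntegrable (fun s => S (t - ε - s) (d n s)) volume 0 (t - ε) :=
      hS.intervalIntegrable h2.1 (hint _ ⟨h2.1, h2.2.trans ht.2⟩)
    rw [mildConv, ← intervalIntegral.integral_add_adjacent_intervals (b := t - ε)
      (h1.mono_set (by rw [uIcc_of_le h2.1, uIcc_of_le ht.1]; exact Icc_subset_Icc_right h2.2))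
      (h1.mono_set (by rw [uIcc_of_le h2.2, uIcc_of_le ht.1]; exact Icc_subset_Icc_left h2.1))]
    congr 1
    rw [mildConv, ← ContinuousLinearMap.intervalIntegral_comp_comm _ h2']
    refine intervalIntegral.integral_congr fun s hs => ?_
    rw [uIcc_of_le h2.1] at hs
    rw [← hS0.add_apply hε.le (sub_nonneg.2 hs.2)]
    congr 2
    ring
  rw [Metric.tendsto_atTop']
  intro r hr
  -- This `η` makes `η D ≤ r / 4`; then `ε ≤ η r / 4` makes `ε η⁻¹ ≤ r / 4`. The `+ 1` covers `D =
  -- 0`.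
  have hη : 0 < r / (4 * (D + 1)) := by positivity
  set η := r / (4 * (D + 1)) with hηdef
  have hε : 0 < min t (η * (r / 4)) := lt_min ht0 (by positivity)
  set ε := min t (η * (r / 4)) with hεdef
  have hsmall : ε * η⁻¹ + η * D ≤ r / 2 := by
    have h1 : ε * η⁻¹ ≤ r / 4 := by
      rw [← div_eq_mul_inv, div_le_iff₀ hη, mul_comm]
      exact min_le_right _ _
    have h2 : η * D ≤ r / 4 := by
      rw [hηdef, div_mul_eq_mul_div, div_le_div_iff₀ (by positivity) (by norm_num)]
      nlinarith
    linarith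
  obtain ⟨N, hN⟩ := Metric.tendsto_atTop'.1 (hhead ε hε (min_le_left _ _)) (r / 2) (half_pos hr)
  refine ⟨N, fun n hn => ?_⟩
  have h1 := hN n hn
  rw [dist_zero_right] at h1 ⊢
  rw [hsplit ε hε (min_le_left _ _) n]
  linarith [norm_add_le (S ε (mildConv S (d n) (t - ε))) (∫ s in (t - ε)..t, S (t - s) (d n s)),
    htail η ε hη hε (min_le_left _ _) n]

theorem isAdmissible_of_forcing {S : ℝ → Y →L[ℝ] Y} (hS : IsContractionFamily S) {a : ℝ} (x₀ : Y)
    {F : ℝ → Y → Y}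
    (hF : ∀ y, AEStronglyMeasurable (fun t => F t y) (volume.restrict (Icc 0 a)))
    (hFc : ∀ᵐ t ∂(volume.restrict (Icc 0 a)), Continuous (F t))
    {α : ℝ → ℝ} {b : ℝ} (hα : IsL2 a α) (hb : ∀ t ∈ Icc 0 a, ∀ y, ‖F t y‖ ≤ α t + b * ‖y‖)
    {w : ℝ → Y} (hw : IsL2 a w) :
    IsAdmissible a S F x₀ (fun t => w t - F t (S t x₀ + mildConv S w t))
      (fun t => S t x₀ + mildConv S w t) := by
  have hx : ContinuousOn (fun t => S t x₀ + mildConv S w t) (Icc 0 a) :=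
    ((hS.continuousOn x₀).mono fun t ht => ht.1).add (hS.continuousOn_mildConv hw.integrable)
  refine ⟨MemLp.sub hw (isL2_superposition hF hFc hα hb hx.isL2), hx, fun t ht => ?_⟩
  simp only [add_sub_cancel]
  exact ⟨hS.intervalIntegrable ht.1 (hw.integrable.mono_measure
    (Measure.restrict_mono (Icc_subset_Icc_right ht.2) le_rfl)), rfl⟩

theorem exists_isOptimalPair [CompleteSpace Y] {S : ℝ → Y →L[ℝ] Y}
    (hS0 : IsC0Semigroup S) (hS : IsContractionFamily S)
    (hS' : IsContractionFamily fun t => ContinuousLinearMap.adjoint (S t)) {a : ℝ} (ha : 0 ≤ a)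
    (hc : ∀ t : ℝ, 0 < t → t ≤ a → IsCompactOperator (S t)) (x₀ : Y) {F : ℝ → Y → Y}
    (hF : ∀ y, AEStronglyMeasurable (fun t => F t y) (volume.restrict (Icc 0 a)))
    (hFc : ∀ᵐ t ∂(volume.restrict (Icc 0 a)), Continuous (F t))
    {α : ℝ → ℝ} {b : ℝ} (hα : IsL2 a α) (hb0 : 0 ≤ b)
    (hb : ∀ t ∈ Icc 0 a, ∀ y, ‖F t y‖ ≤ α t + b * ‖y‖) :
    ∃ u x : ℝ → Y, IsOptimalPair a S F x₀ u x := by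
  set μ := volume.restrict (Icc 0 a) with hμ
  let J : Set ℝ := {c | ∃ u x : ℝ → Y, IsAdmissible a S F x₀ u x ∧ quadraticCost a u x = c}
  have hJne : J.Nonempty :=
    ⟨_, _, _, isAdmissible_of_forcing hS x₀ hF hFc hα hb (w := fun _ => 0) MemLp.zero', rfl⟩
  have hJbdd : BddBelow J := by
    refine ⟨0, ?_⟩
    rintro _ ⟨u, x, -, rfl⟩
    rw [quadraticCost_eq ha]
    exact integral_nonneg fun t => by positivity
  obtain ⟨c, -, hclim, hcJ⟩ := exists_seq_tendsto_sInf hJne hJbdd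
  choose u x hadm hcost using hcJ
  obtain ⟨M, hM⟩ := hclim.bddAbove_range
  have hu : ∀ n, IsL2 a (u n) := fun n => (hadm n).1
  have hx : ∀ n, IsL2 a (x n) := fun n => (hadm n).2.1.isL2
  let w : ℕ → ℝ → Y := fun n t => F t (x n t) + u n t
  have hFx : ∀ n, IsL2 a (fun t => F t (x n t)) := fun n =>
    isL2_superposition hF hFc hα hb (hx n)
  have hw : ∀ n, IsL2 a (w n) := fun n => MemLp.add (hFx n) (hu n)
  have hxw : ∀ n, ∀ t ∈ Icc 0 a, x n t = S t x₀ + mildConv S (w n) t := fun n t ht =>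
    ((hadm n).2.2 t ht).2
  -- From `(|α| + b‖x‖ + ‖u‖)² ≤ 4|α|² + 4b²‖x‖² + 2‖u‖²`, with `M` bounding the costs.
  let C : ℝ := 4 * (∫ t, ‖α t‖ ^ 2 ∂μ) + (4 * b ^ 2 + 2) * M
  have hC : ∀ n, ∫ t, ‖w n t‖ ^ 2 ∂μ ≤ C := by
    intro n
    have hux : Integrable (fun t => ‖u n t‖ ^ 2 + ‖x n t‖ ^ 2) μ :=
      (hu n).integrable_norm_sq.add (hx n).integrable_norm_sq
    have h1 : ∫ t, ‖w n t‖ ^ 2 ∂μ ≤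
        ∫ t, (4 * ‖α t‖ ^ 2 + (4 * b ^ 2 + 2) * (‖u n t‖ ^ 2 + ‖x n t‖ ^ 2)) ∂μ := by
      refine integral_mono_ae (hw n).integrable_norm_sq
        ((hα.integrable_norm_sq.const_mul 4).add (hux.const_mul _)) ?_
      filter_upwards [ae_restrict_mem measurableSet_Icc] with t ht
      have h2 : ‖w n t‖ ≤ (‖α t‖ + b * ‖x n t‖) + ‖u n t‖ :=
        (norm_add_le _ _).trans (add_le_add_left ((hb t ht _).trans
          (add_le_add_left (le_abs_self _) _)) _)
      have h3 : ‖w n t‖ ^ 2 ≤ ((‖α t‖ + b * ‖x n t‖) + ‖u n t‖) ^ 2 :=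
        pow_le_pow_left₀ (norm_nonneg _) h2 2
      refine h3.trans ?_
      nlinarith [sq_nonneg (‖α t‖ - b * ‖x n t‖), sq_nonneg ((‖α t‖ + b * ‖x n t‖) - ‖u n t‖),
        mul_nonneg (sq_nonneg b) (sq_nonneg ‖u n t‖), sq_nonneg ‖x n t‖]
    rw [integral_add (hα.integrable_norm_sq.const_mul 4) (hux.const_mul _), integral_const_mul,
      integral_const_mul] at h1
    refine h1.trans (add_le_add_right (mul_le_mul_of_nonneg_left ?_ (by positivity)) _)
    rw [← quadraticCost_eq ha, hcost]
    exact hM ⟨n, rfl⟩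
  obtain ⟨z, φ, hz, hφ, hweak⟩ := exists_subseq_tendsto_integral_inner hw hC
  let y : ℝ → Y := fun t => S t x₀ + mildConv S z t
  let v : ℝ → Y := fun t => z t - F t (y t)
  have hvy : IsAdmissible a S F x₀ v y := isAdmissible_of_forcing hS x₀ hF hFc hα hb hz
  have hv : IsL2 a v := hvy.1
  have hy : IsL2 a y := hvy.2.1.isL2
  have hxlim : ∀ t ∈ Icc 0 a, Tendsto (fun n => x (φ n) t) atTop (𝓝 (y t)) := by
    intro t ht
    have hd : ∀ n, IsL2 a (fun s => w (φ n) s - z s) := fun n => MemLp.sub (hw _) hz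
    have hD : ∀ n, ∫ s in Icc 0 a, ‖w (φ n) s - z s‖ ^ 2 ≤ 2 * C + 2 * ∫ s, ‖z s‖ ^ 2 ∂μ := by
      intro n
      have h1 : ∫ s in Icc 0 a, ‖w (φ n) s - z s‖ ^ 2 ≤
          ∫ s, (2 * ‖w (φ n) s‖ ^ 2 + 2 * ‖z s‖ ^ 2) ∂μ := by
        refine integral_mono (hd n).integrable_norm_sq
          (((hw _).integrable_norm_sq.const_mul 2).add (hz.integrable_norm_sq.const_mul 2))
          fun s => ?_
        have h2 : ‖w (φ n) s - z s‖ ^ 2 ≤ (‖w (φ n) s‖ + ‖z s‖) ^ 2 :=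
          pow_le_pow_left₀ (norm_nonneg _) (norm_sub_le _ _) 2
        refine h2.trans ?_
        nlinarith [sq_nonneg (‖w (φ n) s‖ - ‖z s‖)]
      rw [integral_add ((hw _).integrable_norm_sq.const_mul 2) (hz.integrable_norm_sq.const_mul 2),
        integral_const_mul, integral_const_mul] at h1
      linarith [hC (φ n)]
    have h1 := tendsto_mildConv_of_weakly_null hS0 hS hS' hc hd hD (fun p hp => by
      have h2 := (hweak p hp).sub_const (∫ s, ⟪z s, p s⟫ ∂μ)
      rw [sub_self] at h2
      refine h2.congr fun n => ?_
      rw [← integral_sub ((hw _).integrable_inner hp) (hz.integrable_inner hp)]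
      simp only [inner_sub_left]) ht
    have h3 := h1.add_const (y t)
    rw [zero_add] at h3
    refine h3.congr fun n => ?_
    have hr : ∀ {f : ℝ → Y}, IsL2 a f → Integrable f (volume.restrict (Icc 0 t)) := fun hf =>
      hf.integrable.mono_measure (Measure.restrict_mono (Icc_subset_Icc_right ht.2) le_rfl)
    rw [mildConv_sub hS ht.1 (hr (hw _)) (hr hz), hxw _ t ht]
    simp only [y]
    abel
  have hxbd : ∃ R : ℝ, ∀ n, ∀ t ∈ Icc 0 a, ‖x n t‖ ≤ R := by
    refine ⟨‖x₀‖ + ((∫ _, (1 : ℝ) ∂μ) + C), fun n t ht => ?_⟩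
    rw [hxw n t ht]
    refine (norm_add_le _ _).trans (add_le_add (hS.norm_le t ht.1 _) ?_)
    refine (hS.norm_mildConv_le ht (hw n).integrable).trans ?_
    refine (integral_mono (hw n).integrable.norm
      ((integrable_const (1 : ℝ)).add (hw n).integrable_norm_sq) fun s => ?_).trans ?_
    · simp only [Pi.add_apply]
      nlinarith [sq_nonneg (‖w n s‖ - 1), norm_nonneg (w n s)]
    · exact (integral_add (integrable_const (1 : ℝ)) (hw n).integrable_norm_sq).trans_le
        (add_le_add_right (hC n) _)
  obtain ⟨R, hR⟩ := hxbd
  have hlim1 : Tendsto (fun n => ∫ t, ‖x (φ n) t‖ ^ 2 ∂μ) atTop (𝓝 (∫ t, ‖y t‖ ^ 2 ∂μ)) := by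
    refine tendsto_integral_of_dominated_convergence (fun _ => R ^ 2)
      (fun n => (hx _).integrable_norm_sq.1) (integrable_const _) (fun n => ?_) ?_
    · filter_upwards [ae_restrict_mem measurableSet_Icc] with t ht
      rw [Real.norm_of_nonneg (by positivity)]
      exact pow_le_pow_left₀ (norm_nonneg _) (hR _ t ht) 2
    · filter_upwards [ae_restrict_mem measurableSet_Icc] with t ht
      exact (hxlim t ht).norm.pow 2
  have hβ : IsL2 a (fun t => ‖α t‖ + b * R) := MemLp.add (MemLp.norm hα) (memLp_const _)
  have hlim2 : Tendsto (fun n => ∫ t, ⟪v t, F t (x (φ n) t)⟫ ∂μ) atTop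
      (𝓝 (∫ t, ⟪v t, F t (y t)⟫ ∂μ)) := by
    refine tendsto_integral_of_dominated_convergence _
      (fun n => (hv.integrable_inner (hFx _)).1) (hv.integrable_norm_mul hβ) (fun n => ?_) ?_
    · filter_upwards [ae_restrict_mem measurableSet_Icc] with t ht
      refine (norm_inner_le_norm _ _).trans (mul_le_mul_of_nonneg_left ?_ (norm_nonneg _))
      refine le_trans ?_ (le_abs_self _)
      exact (hb t ht _).trans (add_le_add (le_abs_self _)
        (mul_le_mul_of_nonneg_left (hR _ t ht) hb0))
    · filter_upwards [ae_restrict_mem measurableSet_Icc, hFc] with t ht hct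
      exact tendsto_const_nhds.inner ((hct.tendsto _).comp (hxlim t ht))
  have hlim3 : Tendsto (fun n => ∫ t, ⟪w (φ n) t, v t⟫ ∂μ) atTop (𝓝 (∫ t, ⟪z t, v t⟫ ∂μ)) :=
    hweak v hv
  -- Lower semicontinuity by hand: `‖u‖² ≥ 2⟪u, v⟫ - ‖v‖²` with `u = w - F(t, x)` bounds the cost
  -- below by terms that all converge.
  have hlower : ∀ n, 2 * (∫ t, ⟪w (φ n) t, v t⟫ ∂μ) - 2 * (∫ t, ⟪v t, F t (x (φ n) t)⟫ ∂μ) -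
      (∫ t, ‖v t‖ ^ 2 ∂μ) + ∫ t, ‖x (φ n) t‖ ^ 2 ∂μ ≤ c (φ n) := by
    intro n
    have i1 := (hw (φ n)).integrable_inner hv
    have i2 := hv.integrable_inner (hFx (φ n))
    have h1 : 2 * (∫ t, ⟪w (φ n) t, v t⟫ ∂μ) - 2 * (∫ t, ⟪v t, F t (x (φ n) t)⟫ ∂μ) -
        (∫ t, ‖v t‖ ^ 2 ∂μ) ≤ ∫ t, ‖u (φ n) t‖ ^ 2 ∂μ := by
      have i3 : Integrable (fun t => 2 * ⟪w (φ n) t, v t⟫ - 2 * ⟪v t, F t (x (φ n) t)⟫) μ :=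
        (i1.const_mul 2).sub (i2.const_mul 2)
      rw [← integral_const_mul, ← integral_const_mul, ← integral_sub (i1.const_mul 2)
        (i2.const_mul 2), ← integral_sub i3
        hv.integrable_norm_sq]
      refine integral_mono (i3.sub hv.integrable_norm_sq)
        (hu _).integrable_norm_sq fun t => ?_
      have h2 := norm_sub_sq_real (u (φ n) t) (v t)
      have h3 : ⟪w (φ n) t, v t⟫ = ⟪v t, F t (x (φ n) t)⟫ + ⟪u (φ n) t, v t⟫ := by
        simp only [w, inner_add_left, real_inner_comm]
      simp only [h3]
      nlinarith [sq_nonneg ‖u (φ n) t - v t‖]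
    rw [← hcost, quadraticCost_eq ha, integral_add (hu _).integrable_norm_sq
      (hx _).integrable_norm_sq]
    linarith
  have hle : quadraticCost a v y ≤ sInf J := by
    have h1 := le_of_tendsto_of_tendsto' ((((hlim3.const_mul 2).sub (hlim2.const_mul 2)).sub_const
      (∫ t, ‖v t‖ ^ 2 ∂μ)).add hlim1) (hclim.comp hφ.tendsto_atTop) hlower
    refine le_trans (le_of_eq ?_) h1
    -- Since `v = z - F(t, y)`, the limit of the lower bounds is exactly the cost of `(v, y)`.
    have h2 : (∫ t, ⟪z t, v t⟫ ∂μ) - (∫ t, ⟪v t, F t (y t)⟫ ∂μ) = ∫ t, ‖v t‖ ^ 2 ∂μ := by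
      rw [← integral_sub (hz.integrable_inner hv)
        (hv.integrable_inner (isL2_superposition hF hFc hα hb hy))]
      refine integral_congr_ae (Eventually.of_forall fun t => ?_)
      simp only
      rw [real_inner_comm, ← inner_sub_right, ← real_inner_self_eq_norm_sq]
    rw [quadraticCost_eq ha, integral_add hv.integrable_norm_sq hy.integrable_norm_sq]
    linarith
  exact ⟨v, y, hvy, fun v' y' h' => hle.trans (csInf_le hJbdd ⟨v', y', h', rfl⟩)⟩

end

/-! ### The optimality system. -/

theorem mainTheorem10 {Y : Type*} [NormedAddCommGroup Y] [InnerProductSpace ℝ Y] [CompleteSpace Y]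
    (a : ℝ) (ha : 0 < a) (x₀ : Y)
    -- `A` generates a strongly continuous semigroup `S`, compact for positive times
    (A : Y →ₗ.[ℝ] Y) (S : ℝ → Y →L[ℝ] Y) (hAS : IsGenerator A S)
    (hcompact : ∀ t : ℝ, 0 < t → t ≤ a → IsCompactOperator (S t))
    -- `-A` is strongly monotone
    (hA : ∃ μ : ℝ, 0 < μ ∧ ∀ y : A.domain, μ * ‖(y : Y)‖ ^ 2 ≤ ⟪-(A y), (y : Y)⟫)
    -- `F` is measurable in `t`, of linear growth, and negatively monotone
    (F : ℝ → Y → Y)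
    (hFmeas : ∀ y : Y, AEStronglyMeasurable (fun t => F t y) (volume.restrict (Icc 0 a)))
    (hFgrowth : ∃ (α : ℝ → ℝ) (b : ℝ), IsL2 a α ∧ 0 < b ∧
      ∀ t ∈ Icc 0 a, ∀ y : Y, ‖F t y‖ ≤ α t + b * ‖y‖)
    (hFmono : ∀ t ∈ Icc 0 a, ∀ y z : Y, ⟪F t y - F t z, y - z⟫ ≤ 0)
    -- `F` is continuously Fréchet differentiable in `x` with derivative `G`, for a.e. `t`
    (G : ℝ → Y → Y →L[ℝ] Y)
    (hFderiv : ∀ᵐ t ∂(volume.restrict (Icc 0 a)),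
      (∀ y : Y, HasFDerivAt (F t) (G t y) y) ∧ Continuous (G t))
    -- the derivative is square-integrable along every `x ∈ L²([0, a], Y)`
    (hGint : ∀ x : ℝ → Y, IsL2 a x → IsL2 a (fun t => ‖G t (x t)‖)) :
    (∃ u x : ℝ → Y, IsOptimalPair a S F x₀ u x) ∧
    ∀ u x : ℝ → Y, IsOptimalPair a S F x₀ u x →
      -- `p` is the continuous representative of the optimal control `u`
      ∃ p : ℝ → Y, p =ᵐ[volume.restrict (Icc 0 a)] u ∧
        -- `ẋ = A x + F(t, x) + p`, `x(0) = x₀`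
        IsMildSolution a S x₀ (fun t => F t (x t) + p t) x ∧
        IsWeakSolution a A.adjoint (fun t => F t (x t) + p t) x ∧
        x 0 = x₀ ∧
        -- `ṗ = -A* p - G*(t, x) p + x`, `p(a) = 0`
        IsBackwardMildSolution a S 0
          (fun t => ContinuousLinearMap.adjoint (G t (x t)) (p t) - x t) p ∧
        IsWeakSolution a (-A)
          (fun t => -(ContinuousLinearMap.adjoint (G t (x t)) (p t)) + x t) p ∧
        p a = 0 := by
  obtain ⟨μ, hμ, hmono⟩ := hA
  obtain ⟨α, b, hα, hb0, hb⟩ := hFgrowth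
  have hdis : ∀ y : A.domain, ⟪A y, (y : Y)⟫ ≤ 0 := by
    intro y
    have h1 := hmono y
    rw [inner_neg_left] at h1
    have h2 : 0 ≤ μ * ‖(y : Y)‖ ^ 2 := by positivity
    linarith
  have hS := hAS.isContractionFamily hdis
  have hS' := hAS.isContractionFamily_adjoint hdis
  have hsep : TopologicalSpace.SeparableSpace Y := hAS.semigroup.separableSpace ha hcompact
  have hFd : ∀ᵐ t ∂(volume.restrict (Icc 0 a)), ∀ y : Y, HasFDerivAt (F t) (G t y) y :=
    hFderiv.mono fun t ht => ht.1
  have hFc : ∀ᵐ t ∂(volume.restrict (Icc 0 a)), Continuous (F t) := hFd.mono fun t ht =>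
    continuous_iff_continuousAt.2 fun y => (ht y).continuousAt
  refine ⟨exists_isOptimalPair hAS.semigroup hS hS' ha.le hcompact x₀ hFmeas hFc hα hb0.le hb,
    fun u x hux => ?_⟩
  have hu : IsL2 a u := hux.1.1
  have hx : IsL2 a x := hux.1.2.1.isL2
  let f : ℝ → Y := fun t => ContinuousLinearMap.adjoint (G t (x t)) (u t) - x t
  let p : ℝ → Y := fun s => ∫ t in s..a, ContinuousLinearMap.adjoint (S (t - s)) (f t)
  have hpu : p =ᵐ[volume.restrict (Icc 0 a)] u :=
    hux.ae_eq_adjoint_state hAS hdis ha hFmeas hα hb hFderiv hGint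
  have hf : Integrable f (volume.restrict (Icc 0 a)) :=
    (integrable_adjoint_fderiv_apply hFmeas hFd hGint hu hx).sub hx.integrable
  have hp := isBackwardMildSolution_integral hAS hdis ha hf
  -- `p` was built from `u`; replacing `u` by `p` in the forcing changes it only on a null set,
  -- which closes the system in `p`.
  let f' : ℝ → Y := fun t => ContinuousLinearMap.adjoint (G t (x t)) (p t) - x t
  have hff' : f =ᵐ[volume.restrict (Icc 0 a)] f' := by
    filter_upwards [hpu] with t ht
    simp only [f, f', ht]
  have hp' : IsBackwardMildSolution a S 0 f' p := hp.congr_forcing hff'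
  have hx' : IsMildSolution a S x₀ (fun t => F t (x t) + p t) x := by
    refine hux.1.2.congr_forcing ?_
    filter_upwards [hpu] with t ht
    rw [ht]
  have hp2 : IsL2 a p := hp.1.isL2
  have hx0 := (hx'.2 0 ⟨le_rfl, ha.le⟩).2
  refine ⟨p, hpu, hx', hx'.isWeakSolution hAS hdis ha
    ((isL2_superposition hFmeas hFc hα hb hx).integrable.add hp2.integrable), ?_, hp', ?_, ?_⟩
  · simpa [hAS.semigroup.zero] using hx0
  · have h1 := hp'.isWeakSolution hAS hdis ha (hf.congr hff')
    have e : (fun t => -(ContinuousLinearMap.adjoint (G t (x t)) (p t)) + x t) =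
        fun t => -f' t := by
      ext t
      simp only [f', neg_sub]
      abel
    rwa [e]
  · simp [p]
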